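/- Let $d \ge 2$ be a fixed integer. In the unipoint model, an uncertain set of $n \ge 1$ points in $\mathbb{R}^d$ consists of sites $p_1,\dots,p_n \in \mathbb{R}^d$ with existence probabilities $\pi_1,\dots,\pi_n \in (0,1]$; the sites exist independently, so that the outcome $B \subseteq \{1,\dots,n\}$ (the set of the indices of the existing sites) has probability $\Pr(B)=\prod_{i\in B}\pi_i\prod_{i\notin B}(1-\pi_i)$. The membership probability of a point $q \in \mathbb{R}^d$ is $$\mu(q)=\sum_{B\subseteq\{1,\dots,n\},\ q\in \mathrm{conv}\{p_i : i\in B\}}\Pr(B).$$ The $n+1$ points $p_1,\dots,p_n,q$ are in general position if, for all $2\le k\le d$, no $k+1$ of them lie on a common hyperplane (of dimension $k-1$) of $\mathbb{R}^k$ after projection to any $k$ of the $d$ coordinates. Theorem. There are a real RAM program and a constant $C$, both depending only on $d$, such that for every $n\ge 1$ and every input $(p_1,\pi_1),\dots,(p_n,\pi_n),q$ with $p_1,\dots,p_n,q$ in general position, the program computes $\mu(q)$ exactly in at most $C n^d$ steps, using at most $C n$ memory cells for words and at most $C n$ memory cells for real numbers (input included), besides a constant number of registers. That is, $\mu(q)$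 can be computed in $O(n^d)$ time and linear space. Here a real RAM performs in one step an exact operation $+,-,\times,/$ or a comparison on real numbers, an operation $+,-,\times$ (with $-$ truncated at $0$) or a comparison on words (natural numbers smaller than $Cn$, i.e. of $O(\log n)$ bits), the setting or copying of a register, or a read or write of a memory cell whose address is in a word register. -/

import Mathlib

/-! ### Uncertain points in the unipoint model -/

namespace Unipoint

/-- Probability of the outcome `B`: site `i` exists with probability `pr i`, independently of the
other sites, and `B` is the set of the (indices of the) sites that exist. -/
noncomputable def outcomeProb {n : ℕ} (pr : Fin n → ℝ) (B : Finset (Fin n)) : ℝ :=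
  (∏ i ∈ B, pr i) * ∏ i ∈ Bᶜ, (1 - pr i)

open Classical in
/-- Membership probability of `q`: the total probability of the outcomes whose convex hull
contains `q`. -/
noncomputable def membershipProb {n d : ℕ} (site : Fin n → Fin d → ℝ) (pr : Fin n → ℝ)
    (q : Fin d → ℝ) : ℝ :=
  ∑ B ∈ Finset.univ.filter
    (fun B : Finset (Fin n) => q ∈ convexHull ℝ (site '' (B : Set (Fin n)))), outcomeProb pr B

/-- General position of a family of points of `ℝ^d`: for `2 ≤ k ≤ d`, no `k + 1` of the points lie
on a common hyperplane `{y | ∑ i, a i * y i = b}` of `ℝ^k` after projection to `k` of the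
coordinates. -/
def GeneralPosition {ι : Type*} {d : ℕ} (x : ι → Fin d → ℝ) : Prop :=
  ∀ k : ℕ, 2 ≤ k → k ≤ d → ∀ (c : Fin k ↪ Fin d) (s : Fin (k + 1) ↪ ι) (a : Fin k → ℝ) (b : ℝ),
    a ≠ 0 → ¬ ∀ j, ∑ i, a i * x (s j) (c i) = b

/-- The family consisting of the sites and the query point. -/
def withQuery {n d : ℕ} (site : Fin n → Fin d → ℝ) (q : Fin d → ℝ) : Option (Fin n) → Fin d → ℝ
  | none => q
  | some i => site i

end Unipoint

/-! ### The real RAM -/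

namespace RealRAM

/-- A configuration of the machine: registers and a random access memory for words (natural numbers
of bounded size), and registers and a random access memory for real numbers. Registers are named in
the program text; memory cells are addressed by the content of a word register. -/
structure State where
  wreg : ℕ → ℕ
  rreg : ℕ → ℝ
  wmem : ℕ → ℕ
  rmem : ℕ → ℝ

/-- The instructions. Real constants in a program are rational; there is no rounding, and
no conversion of reals into words. -/
inductive Instr where
  | wconst (i c : ℕ)
  | wcopy (i j : ℕ)
  | wadd (i j k : ℕ)
  | wsub (i j k : ℕ)
  | wmul (i j k : ℕ)
  | wload (i j : ℕ)
  | wstore (i j : ℕ)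
  | rconst (i : ℕ) (c : ℚ)
  | rcopy (i j : ℕ)
  | radd (i j k : ℕ)
  | rsub (i j k : ℕ)
  | rmul (i j k : ℕ)
  | rdiv (i j k : ℕ)
  | rload (i j : ℕ)
  | rstore (i j : ℕ)

namespace State

def setW (s : State) (i v : ℕ) : State := { s with wreg := Function.update s.wreg i v }

noncomputable def setR (s : State) (i : ℕ) (v : ℝ) : State :=
  { s with rreg := Function.update s.rreg i v }

def setWMem (s : State) (a v : ℕ) : State := { s with wmem := Function.update s.wmem a v }

noncomputable def setRMem (s : State) (a : ℕ) (v : ℝ) : State :=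
  { s with rmem := Function.update s.rmem a v }

end State

/-- Effect of an instruction; `wload i j` and `rload i j` read the cell whose address is in word
register `j`, and `wstore i j` and `rstore i j` write register `j` to the cell whose address is in
word register `i`. -/
noncomputable def Instr.eval : Instr → State → State
  | wconst i c, s => s.setW i c
  | wcopy i j, s => s.setW i (s.wreg j)
  | wadd i j k, s => s.setW i (s.wreg j + s.wreg k)
  | wsub i j k, s => s.setW i (s.wreg j - s.wreg k)
  | wmul i j k, s => s.setW i (s.wreg j * s.wreg k)
  | wload i j, s => s.setW i (s.wmem (s.wreg j))
  | wstore i j, s => s.setWMem (s.wreg i) (s.wreg j)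
  | rconst i c, s => s.setR i (c : ℝ)
  | rcopy i j, s => s.setR i (s.rreg j)
  | radd i j k, s => s.setR i (s.rreg j + s.rreg k)
  | rsub i j k, s => s.setR i (s.rreg j - s.rreg k)
  | rmul i j k, s => s.setR i (s.rreg j * s.rreg k)
  | rdiv i j k, s => s.setR i (s.rreg j / s.rreg k)
  | rload i j, s => s.setR i (s.rmem (s.wreg j))
  | rstore i j, s => s.setRMem (s.wreg i) (s.rreg j)

/-- The instruction can be executed on a machine with `M` memory cells of each kind, whose words
are the numbers below `M` (just large enough for an address): it addresses only existing
cells, produces no word outside that range, and does not divide by zero. Otherwise the machine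
is stuck. -/
def Instr.Ok (M : ℕ) : Instr → State → Prop
  | wconst _ c, _ => c < M
  | wcopy _ j, s => s.wreg j < M
  | wadd _ j k, s => s.wreg j + s.wreg k < M
  | wsub _ j k, s => s.wreg j - s.wreg k < M
  | wmul _ j k, s => s.wreg j * s.wreg k < M
  | wload _ j, s => s.wreg j < M ∧ s.wmem (s.wreg j) < M
  | wstore i j, s => s.wreg i < M ∧ s.wreg j < M
  | rconst _ _, _ => True
  | rcopy _ _, _ => True
  | radd _ _ _, _ => True
  | rsub _ _ _, _ => True
  | rmul _ _ _, _ => True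
  | rdiv _ _ k, s => s.rreg k ≠ 0
  | rload _ j, s => s.wreg j < M
  | rstore i _, s => s.wreg i < M

/-- Comparisons of two registers. -/
inductive Test where
  | wlt (i j : ℕ)
  | weq (i j : ℕ)
  | rlt (i j : ℕ)
  | req (i j : ℕ)

def Test.Holds : Test → State → Prop
  | wlt i j, s => s.wreg i < s.wreg j
  | weq i j, s => s.wreg i = s.wreg j
  | rlt i j, s => s.rreg i < s.rreg j
  | req i j, s => s.rreg i = s.rreg j

/-- Programs. A program is a finite object, so it uses only finitely many registers. -/
inductive Program where
  | skip
  | instr (i : Instr)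
  | seq (P Q : Program)
  | ite (b : Test) (P Q : Program)
  | loop (b : Test) (P : Program)

/-- `Exec M P s t s'`: on a machine with `M` memory cells of each kind (and words below `M`), the
program `P` started in configuration `s` halts after `t` steps in configuration `s'`. Every
instruction and every evaluation of a test is one step. `loop b P` repeats `P` while `b` holds. -/
inductive Exec (M : ℕ) : Program → State → ℕ → State → Prop where
  | skip (s : State) : Exec M .skip s 1 s
  | instr (i : Instr) (s : State) : i.Ok M s → Exec M (.instr i) s 1 (i.eval s)
  | seq {P Q : Program} {s s₁ s₂ : State} {t₁ t₂ : ℕ} :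
      Exec M P s t₁ s₁ → Exec M Q s₁ t₂ s₂ → Exec M (.seq P Q) s (t₁ + t₂) s₂
  | ite_true {b : Test} {P Q : Program} {s s₁ : State} {t : ℕ} :
      b.Holds s → Exec M P s t s₁ → Exec M (.ite b P Q) s (1 + t) s₁
  | ite_false {b : Test} {P Q : Program} {s s₁ : State} {t : ℕ} :
      ¬ b.Holds s → Exec M Q s t s₁ → Exec M (.ite b P Q) s (1 + t) s₁
  | loop_true {b : Test} {P : Program} {s s₁ s₂ : State} {t₁ t₂ : ℕ} :
      b.Holds s → Exec M P s t₁ s₁ → Exec M (.loop b P) s₁ t₂ s₂ →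
      Exec M (.loop b P) s (1 + t₁ + t₂) s₂
  | loop_false {b : Test} {P : Program} {s : State} :
      ¬ b.Holds s → Exec M (.loop b P) s 1 s

/-- The configuration `s` holds the input: `n` is in word register `0`; the real memory holds, one
site after the other, the `d` coordinates and the probability of each site, followed by the `d`
coordinates of the query point. Nothing is known about the other registers and cells. -/
structure HoldsInput {n d : ℕ} (site : Fin n → Fin d → ℝ) (pr : Fin n → ℝ) (q : Fin d → ℝ)
    (s : State) : Prop where
  size : s.wreg 0 = n
  site : ∀ (i : Fin n) (c : Fin d), s.rmem (i * (d + 1) + c) = site i c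
  pr : ∀ i : Fin n, s.rmem (i * (d + 1) + d) = pr i
  query : ∀ c : Fin d, s.rmem (n * (d + 1) + c) = q c

end RealRAM

/-!
The program computes the complementary probability, that the convex hull of the existing sites
avoids the query point, which may be taken to be the origin. Consider vectors in general position
in `ℝ^k` with `k ≥ 2`, and their projections to the first `k - 2` coordinates. If the origin avoids
the hull of the projections, it avoids the hull. Otherwise the cone of the vectors meets the plane
of the last two coordinates in a nonzero planar cone, and the origin avoids the hull if and only if
that cone is pointed. In that case exactly one facet of the cone contains the extreme ray that comes
last in a fixed sense of rotation. The `k - 1` vectors spanning this facet have the origin as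
a positive combination of their projections, which shows in the signs of minors, and all other
existing vectors lie strictly on one side of it. So the probability that given `k - 1` vectors span
the facet is a product over the sites.

The sum over the `O(n^(k-1))` candidates takes `O(n^k)` steps, and the projections are treated
recursively in dimension `k - 2`. General position leaves room for vanishing first coordinates,
which matter only in dimension `1` and are removed by a shear.
-/

/-! ### Programs for formulas with sums and products over the sites -/

namespace RealRAM

@[simp] theorem State.setW_wreg (s : State) (i v : ℕ) :
    (s.setW i v).wreg = Function.update s.wreg i v := rfl

@[simp] theorem State.setW_rmem (s : State) (i v : ℕ) : (s.setW i v).rmem = s.rmem := rfl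

@[simp] theorem State.setR_wreg (s : State) (i : ℕ) (v : ℝ) : (s.setR i v).wreg = s.wreg := rfl

@[simp] theorem State.setR_rreg (s : State) (i : ℕ) (v : ℝ) :
    (s.setR i v).rreg = Function.update s.rreg i v := rfl

/-- Total correctness with a time bound: started in `s`, the program `P` halts after at most `T`
steps in a configuration that satisfies `Q`. -/
def Runs (M : ℕ) (P : Program) (s : State) (T : ℕ) (Q : State → Prop) : Prop :=
  ∃ t s', Exec M P s t s' ∧ t ≤ T ∧ Q s'

namespace Runs

variable {M : ℕ} {P P' : Program} {s : State} {T T' : ℕ} {Q Q' : State → Prop}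

theorem skip (h : Q s) : Runs M .skip s 1 Q := ⟨1, s, .skip s, le_rfl, h⟩

theorem instr {i : Instr} (hi : i.Ok M s) (h : Q (i.eval s)) : Runs M (.instr i) s 1 Q :=
  ⟨1, _, .instr i s hi, le_rfl, h⟩

theorem seq (h : Runs M P s T Q') (h' : ∀ s₁, Q' s₁ → Runs M P' s₁ T' Q) :
    Runs M (.seq P P') s (T + T') Q := by
  obtain ⟨t, s₁, he, ht, hq⟩ := h
  obtain ⟨t', s₂, he', ht', hq'⟩ := h' s₁ hq
  exact ⟨_, s₂, .seq he he', by omega, hq'⟩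

theorem instr_seq {i : Instr} (hi : i.Ok M s) (h : Runs M P (i.eval s) T Q) :
    Runs M (.seq (.instr i) P) s (1 + T) Q :=
  seq (Q' := (· = i.eval s)) (instr hi rfl) fun _ hs => hs ▸ h

theorem ite {b : Test} (h : b.Holds s → Runs M P s T Q) (h' : ¬ b.Holds s → Runs M P' s T' Q) :
    Runs M (.ite b P P') s (1 + (T + T')) Q := by
  by_cases hb : b.Holds s
  · obtain ⟨t, s₁, he, ht, hq⟩ := h hb
    exact ⟨_, s₁, .ite_true hb he, by omega, hq⟩
  · obtain ⟨t, s₁, he, ht, hq⟩ := h' hb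
    exact ⟨_, s₁, .ite_false hb he, by omega, hq⟩

theorem mono (h : Runs M P s T Q') (hT : T ≤ T') (hQ : ∀ s', Q' s' → Q s') :
    Runs M P s T' Q := by
  obtain ⟨t, s₁, he, ht, hq⟩ := h
  exact ⟨t, s₁, he, ht.trans hT, hQ _ hq⟩

theorem loop {b : Test} {n : ℕ} {Inv : ℕ → State → Prop}
    (hb : ∀ i s, Inv i s → (b.Holds s ↔ i < n))
    (hP : ∀ i s, i < n → Inv i s → Runs M P s T (Inv (i + 1))) (hs : Inv 0 s) :
    Runs M (.loop b P) s (n * (T + 1) + 1) (Inv n) := by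
  suffices ∀ k i s, i + k = n → Inv i s → Runs M (.loop b P) s (k * (T + 1) + 1) (Inv n) from
    this n 0 s (by omega) hs
  intro k
  induction k with
  | zero =>
    intro i s hi hs
    obtain rfl : i = n := by omega
    exact ⟨1, s, .loop_false (by rw [hb _ _ hs]; omega), by omega, hs⟩
  | succ k ih =>
    intro i s hi hs
    obtain ⟨t, s₁, he, ht, hq⟩ := hP i s (by omega) hs
    obtain ⟨t', s₂, he', ht', hq'⟩ := ih (i + 1) s₁ (by omega) hq
    refine ⟨_, s₂, .loop_true ((hb _ _ hs).2 (by omega)) he he', ?_, hq'⟩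
    rw [Nat.succ_mul]
    omega

end Runs

/-- `s'` agrees with `s` on the word registers below `3 + a`, the real registers up to `m`
and the real memory. Word registers `0`, `1`, `2` and real register `0` are thus always protected:
they hold what every evaluation needs (see `Env.Loaded`). -/
structure Frame (a m : ℕ) (s s' : State) : Prop where
  wreg : ∀ i < 3 + a, s'.wreg i = s.wreg i
  rreg : ∀ i ≤ m, s'.rreg i = s.rreg i
  rmem : s'.rmem = s.rmem

namespace Frame

variable {a a' m m' : ℕ} {s s' s'' : State}

theorem refl (a m : ℕ) (s : State) : Frame a m s s := ⟨fun _ _ => rfl, fun _ _ => rfl, rfl⟩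

theorem trans (h : Frame a m s s') (h' : Frame a m s' s'') : Frame a m s s'' where
  wreg i hi := (h'.wreg i hi).trans (h.wreg i hi)
  rreg i hi := (h'.rreg i hi).trans (h.rreg i hi)
  rmem := h'.rmem.trans h.rmem

theorem anti (h : Frame a' m' s s') (ha : a ≤ a') (hm : m ≤ m') : Frame a m s s' where
  wreg i hi := h.wreg i (by omega)
  rreg i hi := h.rreg i (by omega)
  rmem := h.rmem

theorem setW (h : Frame a m s s') {i : ℕ} (hi : 3 + a ≤ i) (v : ℕ) :
    Frame a m s (s'.setW i v) where
  wreg j hj := by rw [State.setW_wreg, Function.update_of_ne (by omega), h.wreg j hj]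
  rreg := h.rreg
  rmem := h.rmem

theorem setR (h : Frame a m s s') {i : ℕ} (hi : m < i) (v : ℝ) :
    Frame a m s (s'.setR i v) where
  wreg := h.wreg
  rreg j hj := by rw [State.setR_rreg, Function.update_of_ne (by omega), h.rreg j hj]
  rmem := h.rmem

end Frame

/-- The data a formula with `a` free site variables may refer to: an input in the unipoint model in
dimension `d`, a real parameter, and the values of the site variables. -/
structure Env (d a : ℕ) where
  size : ℕ
  site : Fin size → Fin d → ℝ
  pr : Fin size → ℝ
  query : Fin d → ℝ
  param : ℝ
  var : Fin a → Fin size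

variable {d a : ℕ}

namespace Env

/-- The environment with one more site variable, for the body of a sum or product over the sites. -/
def push (E : Env d a) (i : Fin E.size) : Env d (a + 1) where
  __ := E
  var := Fin.snoc E.var i

theorem pr_push (E : Env d a) (i : Fin E.size) : (E.push i).pr = E.pr :=
  rfl

theorem push_var_last (E : Env d a) (i : Fin E.size) : (E.push i).var (Fin.last a) = i :=
  Fin.snoc_last (α := fun _ => Fin E.size) i E.var

theorem push_var_castSucc (E : Env d a) (i : Fin E.size) (j : Fin a) :
    (E.push i).var j.castSucc = E.var j :=
  Fin.snoc_castSucc (α := fun _ => Fin E.size) i E.var j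

/-- `E` is loaded in configuration `s` of a machine with `M` memory cells: besides the input, the
word registers `1`, `2` and `3 + i` hold the constants `1` and `d + 1` and the site variable `i`,
and the real register `0` holds the parameter. -/
structure Loaded (M : ℕ) (E : Env d a) (s : State) : Prop where
  size_pos : 1 ≤ E.size
  lt_mem : E.size * (d + 1) + d < M
  input : HoldsInput E.site E.pr E.query s
  one : s.wreg 1 = 1
  stride : s.wreg 2 = d + 1
  var : ∀ i : Fin a, s.wreg (3 + i) = E.var i
  param : s.rreg 0 = E.param

namespace Loaded

variable {M m : ℕ} {E : Env d a} {s s' : State}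

theorem frame (h : E.Loaded M s) (hf : Frame a m s s') : E.Loaded M s' where
  size_pos := h.size_pos
  lt_mem := h.lt_mem
  input :=
    { size := (hf.wreg 0 (by omega)).trans h.input.size
      site := by rw [hf.rmem]; exact h.input.site
      pr := by rw [hf.rmem]; exact h.input.pr
      query := by rw [hf.rmem]; exact h.input.query }
  one := (hf.wreg 1 (by omega)).trans h.one
  stride := (hf.wreg 2 (by omega)).trans h.stride
  var i := (hf.wreg _ (by omega)).trans (h.var i)
  param := (hf.rreg 0 (by omega)).trans h.param

theorem push (h : E.Loaded M s) {i : Fin E.size} (hi : s.wreg (3 + a) = i) :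
    (E.push i).Loaded M s where
  size_pos := h.size_pos
  lt_mem := h.lt_mem
  input := h.input
  one := h.one
  stride := h.stride
  var j := by
    refine Fin.lastCases ?_ (fun j => ?_) j
    · simpa [Env.push] using hi
    · simpa [Env.push] using h.var j
  param := h.param

theorem size_lt (h : E.Loaded M s) : E.size < M := by
  have := h.lt_mem
  nlinarith

theorem lt_of_le (h : E.Loaded M s) {c : ℕ} (hc : c ≤ d + 1) : c < M := by
  have h₁ := h.size_pos
  have h₂ := h.lt_mem
  nlinarith

end Loaded

end Env

/-- Some program brings about `Q E` from any configuration in which `E` is loaded, in `O(n ^ k)`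
steps for `n` sites, without touching what `Frame a m` protects. -/
def Achievable (m k : ℕ) (Q : Env d a → State → Prop) : Prop :=
  ∃ (P : Program) (K : ℕ), ∀ (E : Env d a) (M : ℕ) (s : State), E.Loaded M s →
    Runs M P s (K * E.size ^ k) fun s' => Frame a m s s' ∧ Q E s'

namespace Achievable

variable {k m m' : ℕ} {Q Q' Q'' : Env d a → State → Prop}

theorem of_runs {T : ℕ} (P : Program)
    (h : ∀ (E : Env d a) (M : ℕ) (s : State), E.Loaded M s →
      Runs M P s T fun s' => Frame a m s s' ∧ Q E s') : Achievable m k Q :=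
  ⟨P, T, fun E M s hs => (h E M s hs).mono
    (Nat.le_mul_of_pos_right _ (Nat.pow_pos hs.size_pos)) fun _ => id⟩

theorem mono {k' : ℕ} (h : Achievable m k Q) (hk : k ≤ k') (hQ : ∀ E s, Q E s → Q' E s) :
    Achievable m k' Q' := by
  obtain ⟨P, K, hP⟩ := h
  exact ⟨P, K, fun E M s hs => (hP E M s hs).mono
    (Nat.mul_le_mul_left _ (Nat.pow_le_pow_right hs.size_pos hk))
    fun s' hs' => ⟨hs'.1, hQ E s' hs'.2⟩⟩

theorem seq (h : Achievable m k Q) (h' : Achievable m' k Q') (hm : m ≤ m')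
    (hQ : ∀ E s s', Q E s → Frame a m' s s' → Q E s') :
    Achievable m k fun E s => Q E s ∧ Q' E s := by
  obtain ⟨P, K, hP⟩ := h
  obtain ⟨P', K', hP'⟩ := h'
  refine ⟨.seq P P', K + K', fun E M s hs => ?_⟩
  rw [add_mul]
  refine (hP E M s hs).seq fun s₁ ⟨hf, h₁⟩ => (hP' E M s₁ (hs.frame hf)).mono le_rfl ?_
  exact fun s₂ ⟨hf', h₂⟩ => ⟨hf.trans (hf'.anti le_rfl hm), hQ E s₁ s₂ h₁ hf', h₂⟩

theorem instr_after (h : Achievable m k Q) (i : Instr)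
    (hi : ∀ E M s, Q E s → i.Ok M s ∧ Frame a m s (i.eval s) ∧ Q' E (i.eval s)) :
    Achievable m k Q' := by
  obtain ⟨P, K, hP⟩ := h
  refine ⟨.seq P (.instr i), K + 1, fun E M s hs => ?_⟩
  have hrun : Runs M (.seq P (.instr i)) s (K * E.size ^ k + 1)
      fun s' => Frame a m s s' ∧ Q' E s' := by
    refine (hP E M s hs).seq fun s₁ ⟨hf, h₁⟩ => ?_
    obtain ⟨hok, hf', h₂⟩ := hi E M s₁ h₁
    exact Runs.instr hok ⟨hf.trans hf', h₂⟩
  refine hrun.mono ?_ fun _ => id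
  have := Nat.pow_pos (n := k) hs.size_pos
  nlinarith

theorem ite {b : Test} {p : Env d a → Prop} [DecidablePred p]
    (h : Achievable m k fun E s => b.Holds s ↔ p E) (h₁ : Achievable m k Q)
    (h₂ : Achievable m k Q') : Achievable m k fun E s => if p E then Q E s else Q' E s := by
  obtain ⟨P, K, hP⟩ := h
  obtain ⟨P₁, K₁, hP₁⟩ := h₁
  obtain ⟨P₂, K₂, hP₂⟩ := h₂
  refine ⟨.seq P (.ite b P₁ P₂), K + (1 + (K₁ + K₂)), fun E M s hs => ?_⟩
  have hrun : Runs M (.seq P (.ite b P₁ P₂)) s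
      (K * E.size ^ k + (1 + (K₁ * E.size ^ k + K₂ * E.size ^ k)))
      fun s' => Frame a m s s' ∧ if p E then Q E s' else Q' E s' := by
    refine (hP E M s hs).seq fun s₁ ⟨hf, hb⟩ => Runs.ite (fun h => ?_) (fun h => ?_)
    · refine (hP₁ E M s₁ (hs.frame hf)).mono le_rfl fun s₂ ⟨hf', h₁⟩ => ⟨hf.trans hf', ?_⟩
      rwa [if_pos (hb.1 h)]
    · refine (hP₂ E M s₁ (hs.frame hf)).mono le_rfl fun s₂ ⟨hf', h₂⟩ => ⟨hf.trans hf', ?_⟩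
      rwa [if_neg (mt hb.2 h)]
  refine hrun.mono ?_ fun _ => id
  have := Nat.pow_pos (n := k) hs.size_pos
  nlinarith

end Achievable

/-- Some program, for each choice of the registers `≤ m` to be spared, computes `F E` into real
register `m + 1` in `O(n ^ k)` steps. -/
def Evaluable (k : ℕ) (F : Env d a → ℝ) : Prop :=
  ∀ m, Achievable m k fun E s => s.rreg (m + 1) = F E

/-- Some program prepares, in `O(n ^ k)` steps, a test that decides whether `p E`. -/
def Checkable (k : ℕ) (p : Env d a → Prop) : Prop :=
  ∀ m, ∃ b : Test, Achievable m k fun E s => b.Holds s ↔ p E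

section Evaluable

variable {k : ℕ} {F G : Env d a → ℝ} {p p' : Env d a → Prop}

theorem Evaluable.mono {k' : ℕ} (h : Evaluable k F) (hk : k ≤ k') : Evaluable k' F :=
  fun m => (h m).mono hk fun _ _ => id

theorem Evaluable.const (k : ℕ) (c : ℚ) : Evaluable k fun _ : Env d a => (c : ℝ) := fun m =>
  .of_runs (.instr (.rconst (m + 1) c)) fun _ _ s _ => Runs.instr trivial
    ⟨(Frame.refl a m s).setR m.lt_succ_self c, by simp [Instr.eval]⟩

theorem Evaluable.zero (k : ℕ) : Evaluable k fun _ : Env d a => (0 : ℝ) := by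
  simpa using Evaluable.const k 0

theorem Evaluable.one (k : ℕ) : Evaluable k fun _ : Env d a => (1 : ℝ) := by
  simpa using Evaluable.const k 1

theorem Evaluable.param (k : ℕ) : Evaluable k fun E : Env d a => E.param := fun m =>
  .of_runs (.instr (.rcopy (m + 1) 0)) fun _ _ s hs => Runs.instr trivial
    ⟨(Frame.refl a m s).setR m.lt_succ_self _, by simp [Instr.eval, hs.param]⟩

theorem Evaluable.rmem (k j : ℕ) {c : ℕ} (hc : c ≤ d) {v : Env d a → ℕ} (hv : ∀ E, v E ≤ E.size)
    (hj : ∀ E M s, E.Loaded M s → s.wreg j = v E)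
    (hF : ∀ E M s, E.Loaded M s → s.rmem (v E * (d + 1) + c) = F E) : Evaluable k F := by
  refine fun m => .of_runs (T := 4)
    (.seq (.instr (.wmul (3 + a) j 2)) (.seq (.instr (.wconst (4 + a) c))
      (.seq (.instr (.wadd (3 + a) (3 + a) (4 + a))) (.instr (.rload (m + 1) (3 + a))))))
    fun E M s hs => ?_
  have hne : 3 + a ≠ 4 + a := by omega
  have hlt : v E * (d + 1) + c < M := by
    have := Nat.mul_le_mul_right (d + 1) (hv E)
    have := hs.lt_mem
    omega
  have hj := hj E M s hs
  refine Runs.instr_seq ?_ <| Runs.instr_seq ?_ <| Runs.instr_seq ?_ <| Runs.instr ?_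
    ⟨((((Frame.refl a m s).setW ?_ _).setW ?_ _).setW ?_ _).setR ?_ _, ?_⟩
  · simp only [Instr.Ok, hj, hs.stride]
    omega
  · exact hs.lt_of_le (by omega)
  · simpa [Instr.Ok, Instr.eval, hj, hs.stride, hne] using hlt
  · simpa [Instr.Ok, Instr.eval, hj, hs.stride, hne] using hlt
  iterate 4 omega
  · simpa [Instr.eval, hj, hs.stride, hne] using hF E M s hs

theorem Evaluable.coord (k : ℕ) (i : Fin a) (c : Fin d) :
    Evaluable k fun E : Env d a => E.site (E.var i) c :=
  .rmem k (3 + i) c.2.le (fun E => (E.var i).2.le) (fun _ _ _ hs => hs.var i)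
    fun _ _ _ hs => hs.input.site _ c

theorem Evaluable.prob (k : ℕ) (i : Fin a) : Evaluable k fun E : Env d a => E.pr (E.var i) :=
  .rmem k (3 + i) le_rfl (fun E => (E.var i).2.le) (fun _ _ _ hs => hs.var i)
    fun _ _ _ hs => hs.input.pr _

theorem Evaluable.query (k : ℕ) (c : Fin d) : Evaluable k fun E : Env d a => E.query c :=
  .rmem k 0 c.2.le (fun _ => le_rfl) (fun _ _ _ hs => hs.input.size)
    fun _ _ _ hs => hs.input.query c

theorem Evaluable.pair (hF : Evaluable k F) (hG : Evaluable k G) (m : ℕ) :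
    Achievable m k fun E s => s.rreg (m + 1) = F E ∧ s.rreg (m + 2) = G E :=
  (hF m).seq (hG (m + 1)) (by omega) fun _ _ _ h hf => (hf.rreg _ le_rfl).trans h

theorem Evaluable.instr (hF : Evaluable k F) (hG : Evaluable k G) {op : ℝ → ℝ → ℝ}
    (i : ℕ → Instr) (hi : ∀ m E M s, s.rreg (m + 1) = F E → s.rreg (m + 2) = G E →
      (i m).Ok M s ∧ (i m).eval s = s.setR (m + 1) (op (F E) (G E))) :
    Evaluable k fun E => op (F E) (G E) := fun m =>
  (hF.pair hG m).instr_after (i m) fun E M s ⟨h₁, h₂⟩ => by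
    obtain ⟨hok, heval⟩ := hi m E M s h₁ h₂
    rw [heval]
    exact ⟨hok, (Frame.refl a m s).setR m.lt_succ_self _, by simp⟩

theorem Evaluable.add (hF : Evaluable k F) (hG : Evaluable k G) :
    Evaluable k fun E => F E + G E :=
  hF.instr hG (fun m => .radd (m + 1) (m + 1) (m + 2)) fun m E M s h₁ h₂ =>
    ⟨trivial, by rw [Instr.eval, h₁, h₂]⟩

theorem Evaluable.sub (hF : Evaluable k F) (hG : Evaluable k G) :
    Evaluable k fun E => F E - G E :=
  hF.instr hG (fun m => .rsub (m + 1) (m + 1) (m + 2)) fun m E M s h₁ h₂ =>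
    ⟨trivial, by rw [Instr.eval, h₁, h₂]⟩

theorem Evaluable.mul (hF : Evaluable k F) (hG : Evaluable k G) :
    Evaluable k fun E => F E * G E :=
  hF.instr hG (fun m => .rmul (m + 1) (m + 1) (m + 2)) fun m E M s h₁ h₂ =>
    ⟨trivial, by rw [Instr.eval, h₁, h₂]⟩

theorem Evaluable.div_of_ne_zero (hF : Evaluable k F) (hG : Evaluable k G) (h0 : ∀ E, G E ≠ 0) :
    Evaluable k fun E => F E / G E :=
  hF.instr hG (fun m => .rdiv (m + 1) (m + 1) (m + 2)) fun m E M s h₁ h₂ =>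
    ⟨by simpa [Instr.Ok, h₂] using h0 E, by rw [Instr.eval, h₁, h₂]⟩

theorem Evaluable.ite [DecidablePred p] (hp : Checkable k p) (hF : Evaluable k F)
    (hG : Evaluable k G) : Evaluable k fun E => if p E then F E else G E := fun m => by
  obtain ⟨b, hb⟩ := hp m
  refine (hb.ite (hF m) (hG m)).mono le_rfl fun E s h => ?_
  by_cases hE : p E <;> simpa [hE] using h

theorem Checkable.lt (hF : Evaluable k F) (hG : Evaluable k G) :
    Checkable k fun E => F E < G E := fun m =>
  ⟨.rlt (m + 1) (m + 2), (hF.pair hG m).mono le_rfl fun _ _ ⟨h₁, h₂⟩ => by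
    simp only [Test.Holds, h₁, h₂]⟩

theorem Checkable.eq (hF : Evaluable k F) (hG : Evaluable k G) :
    Checkable k fun E => F E = G E := fun m =>
  ⟨.req (m + 1) (m + 2), (hF.pair hG m).mono le_rfl fun _ _ ⟨h₁, h₂⟩ => by
    simp only [Test.Holds, h₁, h₂]⟩

theorem Checkable.pos (hF : Evaluable k F) : Checkable k fun E => 0 < F E :=
  .lt (.zero k) hF

theorem Checkable.of_test (k : ℕ) (b : Test) (hb : ∀ E M s, E.Loaded M s → (b.Holds s ↔ p E)) :
    Checkable k p := fun m =>
  ⟨b, .of_runs .skip fun E M s hs => Runs.skip ⟨Frame.refl a m s, hb E M s hs⟩⟩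

theorem Checkable.var_lt (k : ℕ) (i j : Fin a) :
    Checkable k fun E : Env d a => E.var i < E.var j :=
  .of_test k (.wlt (3 + i) (3 + j)) fun E M s hs => by
    simp only [Test.Holds, hs.var, Fin.val_fin_lt]

theorem Checkable.var_eq (k : ℕ) (i j : Fin a) :
    Checkable k fun E : Env d a => E.var i = E.var j :=
  .of_test k (.weq (3 + i) (3 + j)) fun E M s hs => by
    simp only [Test.Holds, hs.var, Fin.val_inj]

theorem Checkable.size_eq_one (k : ℕ) : Checkable k fun E : Env d a => E.size = 1 :=
  .of_test k (.weq 0 1) fun E M s hs => by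
    simp only [Test.Holds, hs.input.size, hs.one]

theorem Checkable.iff_indicator [DecidablePred p] :
    Checkable k p ↔ Evaluable k fun E => if p E then (1 : ℝ) else 0 := by
  refine ⟨fun h => .ite h (.one k) (.zero k), fun h => ?_⟩
  refine (show (fun E => 0 < if p E then (1 : ℝ) else 0) = p from ?_) ▸ Checkable.pos h
  ext E
  split_ifs with hE <;> simp [hE]

theorem Checkable.not (hp : Checkable k p) : Checkable k fun E => ¬ p E := by
  classical
  rw [Checkable.iff_indicator]
  simpa [ite_not] using Evaluable.ite hp (.zero k) (.one k)

theorem Checkable.and (hp : Checkable k p) (hp' : Checkable k p') :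
    Checkable k fun E => p E ∧ p' E := by
  classical
  rw [Checkable.iff_indicator]
  simpa [ite_and] using Evaluable.ite hp (.ite hp' (.one k) (.zero k)) (.zero k)

theorem Checkable.forall {ι : Type*} [Finite ι] {p : ι → Env d a → Prop}
    (hp : ∀ i, Checkable k (p i)) : Checkable k fun E => ∀ i, p i E := by
  classical
  suffices ∀ s : Set ι, s.Finite → Checkable k fun E => ∀ i ∈ s, p i E by
    simpa using this Set.univ Set.finite_univ
  intro s hs
  induction s, hs using Set.Finite.induction_on with
  | empty => simpa using Checkable.iff_indicator.2 (by simpa using Evaluable.one k)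
  | insert _ _ ih => simpa using (hp _).and ih

theorem Checkable.exists {ι : Type*} [Finite ι] {p : ι → Env d a → Prop}
    (hp : ∀ i, Checkable k (p i)) : Checkable k fun E => ∃ i, p i E := by
  simpa using Checkable.not (.forall fun i => (hp i).not)

theorem Evaluable.div (hF : Evaluable k F) (hG : Evaluable k G) :
    Evaluable k fun E => F E / G E := by
  have h0 : Checkable k fun E => G E = 0 := .eq hG (.zero k)
  have hsafe : Evaluable k fun E => F E / if G E = 0 then 1 else G E :=
    hF.div_of_ne_zero (.ite h0 (.one k) hG) fun E => by
      split_ifs with h <;> simp [h]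
  convert Evaluable.ite h0 (.zero k) hsafe using 2 with E
  split_ifs with h <;> simp [h]

theorem Evaluable.finset_sum {ι : Type*} (s : Finset ι) {F : ι → Env d a → ℝ}
    (h : ∀ i, Evaluable k (F i)) : Evaluable k fun E => ∑ i ∈ s, F i E := by
  classical
  induction s using Finset.induction_on with
  | empty => simpa using Evaluable.zero k
  | insert i s hi ih => simpa [Finset.sum_insert hi] using (h i).add ih

theorem Evaluable.finset_prod {ι : Type*} (s : Finset ι) {F : ι → Env d a → ℝ}
    (h : ∀ i, Evaluable k (F i)) : Evaluable k fun E => ∏ i ∈ s, F i E := by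
  classical
  induction s using Finset.induction_on with
  | empty => simpa using Evaluable.one k
  | insert i s hi ih => simpa [Finset.prod_insert hi] using (h i).mul ih

theorem Env.Loaded.runs_forEach {M m T : ℕ} {E : Env d a} {s : State} (hs : E.Loaded M s)
    {P : Program} {J : ℕ → (ℕ → ℝ) → Prop} (hzero : J 0 s.rreg)
    (hP : ∀ (i : Fin E.size) (s' : State), (E.push i).Loaded M s' → J i s'.rreg →
      Runs M P s' T fun s'' => Frame (a + 1) m s' s'' ∧ J (i + 1) s''.rreg) :
    Runs M (.seq (.instr (.wconst (3 + a) 0))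
      (.loop (.wlt (3 + a) 0) (.seq P (.instr (.wadd (3 + a) (3 + a) 1))))) s
      (1 + (E.size * (T + 1 + 1) + 1)) fun s' => Frame a m s s' ∧ J E.size s'.rreg := by
  let Inv (x : ℕ) (s' : State) : Prop :=
    Frame a m s s' ∧ s'.wreg (3 + a) = x ∧ J x s'.rreg
  have htest : ∀ x s', Inv x s' → ((Test.wlt (3 + a) 0).Holds s' ↔ x < E.size) := by
    rintro x s' ⟨hf, hx, -⟩
    simp only [Test.Holds, hx, (hs.frame hf).input.size]
  have hbody : ∀ x s', x < E.size → Inv x s' →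
      Runs M (.seq P (.instr (.wadd (3 + a) (3 + a) 1))) s' (T + 1) (Inv (x + 1)) := by
    rintro x s' hx ⟨hf, hwx, hJ⟩
    have hs' := hs.frame hf
    refine (hP ⟨x, hx⟩ s' (hs'.push hwx) hJ).seq fun s₁ ⟨hf₁, hJ₁⟩ => ?_
    have hwx₁ : s₁.wreg (3 + a) = x := (hf₁.wreg _ (by omega)).trans hwx
    have hone : s₁.wreg 1 = 1 := (hf₁.wreg 1 (by omega)).trans hs'.one
    refine Runs.instr ?_ ⟨(hf.trans (hf₁.anti a.le_succ le_rfl)).setW le_rfl _, ?_, hJ₁⟩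
    · have := hs.size_lt
      simp only [Instr.Ok, hwx₁, hone]
      omega
    · simp [Instr.eval, hwx₁, hone]
  have hinit : Inv 0 (s.setW (3 + a) 0) := ⟨(Frame.refl a m s).setW le_rfl _, by simp, hzero⟩
  exact Runs.instr_seq (hs.lt_of_le (by omega))
    ((Runs.loop htest hbody hinit).mono le_rfl fun s' h => ⟨h.1, h.2.2⟩)

/-- The sequence `G E` lists the intermediate values of `r` in the loop
`r := c; for each site j: r := op r (F (E.push j))`. -/
theorem Evaluable.fold {F : Env d (a + 1) → ℝ} (hF : Evaluable k F) {op : ℝ → ℝ → ℝ} {c : ℚ}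
    (i : ℕ → Instr) (hi : ∀ m M s, (i m).Ok M s ∧
      (i m).eval s = s.setR (m + 1) (op (s.rreg (m + 1)) (s.rreg (m + 2))))
    {G : Env d a → ℕ → ℝ} (hzero : ∀ E, G E 0 = c)
    (hsucc : ∀ E (j : Fin E.size), G E (j + 1) = op (G E j) (F (E.push j))) :
    Evaluable (k + 1) fun E => G E E.size := by
  intro m
  obtain ⟨P, K, hP⟩ := hF (m + 1)
  refine ⟨.seq (.instr (.rconst (m + 1) c)) (.seq (.instr (.wconst (3 + a) 0))
    (.loop (.wlt (3 + a) 0) (.seq (.seq P (.instr (i m))) (.instr (.wadd (3 + a) (3 + a) 1))))),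
    K + 6, fun E M s hs => ?_⟩
  have hf : Frame a m s (s.setR (m + 1) c) := (Frame.refl a m s).setR m.lt_succ_self _
  refine Runs.mono (Runs.instr_seq trivial <| (hs.frame hf).runs_forEach (m := m)
    (T := K * E.size ^ k + 1) (J := fun x r => r (m + 1) = G E x) (by simp [hzero])
    fun j s' hs' hr => (hP _ M s' hs').seq fun s₁ ⟨hf₁, h₁⟩ => ?_) ?_
    fun s' h => ⟨hf.trans h.1, h.2⟩
  · obtain ⟨hok, heval⟩ := hi m M s₁
    refine Runs.instr hok ?_
    rw [heval]
    refine ⟨(hf₁.anti le_rfl m.le_succ).setR m.lt_succ_self _, ?_⟩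
    simp [hsucc, h₁, hf₁.rreg _ le_rfl, hr]
  · have h₁ := Nat.le_mul_of_pos_left E.size (Nat.pow_pos (n := k) hs.size_pos)
    have h₂ := hs.size_pos
    rw [pow_succ]
    nlinarith

theorem Evaluable.sum {F : Env d (a + 1) → ℝ} (hF : Evaluable k F) :
    Evaluable (k + 1) fun E : Env d a => ∑ j, F (E.push j) := by
  let term (E : Env d a) (x : ℕ) : ℝ := if hx : x < E.size then F (E.push ⟨x, hx⟩) else 0
  have h := hF.fold (c := 0) (op := (· + ·)) (fun m => .radd (m + 1) (m + 1) (m + 2))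
    (fun _ _ _ => ⟨trivial, rfl⟩) (G := fun E x => ∑ y ∈ Finset.range x, term E y) (by simp)
    fun E j => by simp [Finset.sum_range_succ, term]
  simpa [Finset.sum_range, term] using h

theorem Evaluable.prod {F : Env d (a + 1) → ℝ} (hF : Evaluable k F) :
    Evaluable (k + 1) fun E : Env d a => ∏ j, F (E.push j) := by
  let term (E : Env d a) (x : ℕ) : ℝ := if hx : x < E.size then F (E.push ⟨x, hx⟩) else 1
  have h := hF.fold (c := 1) (op := (· * ·)) (fun m => .rmul (m + 1) (m + 1) (m + 2))
    (fun _ _ _ => ⟨trivial, rfl⟩) (G := fun E x => ∏ y ∈ Finset.range x, term E y) (by simp)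
    fun E j => by simp [Finset.prod_range_succ, term]
  simpa [Finset.prod_range, term] using h

theorem Evaluable.det {ι : Type*} [Fintype ι] [DecidableEq ι] {A : Env d a → Matrix ι ι ℝ}
    (hA : ∀ i j, Evaluable k fun E => A E i j) : Evaluable k fun E => (A E).det := by
  simp only [Matrix.det_apply']
  exact .finset_sum _ fun σ => .mul (by simpa using Evaluable.const k (Equiv.Perm.sign σ : ℤ))
    (.finset_prod _ fun i => hA _ _)

/-- The environment with the site variables `f`. -/
def Env.withVar (E : Env d 0) {m : ℕ} (f : Fin m → Fin E.size) : Env d m where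
  __ := E
  var := f

theorem Evaluable.sum_pi : ∀ {k m : ℕ} {F : Env d m → ℝ}, Evaluable k F →
    Evaluable (k + m) fun E : Env d 0 => ∑ f : Fin m → Fin E.size, F (E.withVar f)
  | _, 0, F, hF => by
    have hE (E : Env d 0) : ∑ f : Fin 0 → Fin E.size, F (E.withVar f) = F E := by
      rw [Fintype.sum_unique]
      exact congrArg (fun f => F (E.withVar f)) (Subsingleton.elim _ E.var)
    simpa only [hE, add_zero] using hF
  | _, m + 1, F, hF => by
    have h := Evaluable.sum_pi hF.sum
    rw [add_assoc, add_comm 1] at h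
    convert h using 2 with E
    rw [← (Fin.snocEquiv fun _ => Fin E.size).sum_comp, Fintype.sum_prod_type, Finset.sum_comm]
    rfl

/-- The parameter serves to evaluate `G` only once, before `F`. -/
theorem exists_program {k : ℕ} {F G : Env d 0 → ℝ} (hG : Evaluable k G) (hF : Evaluable k F) :
    ∃ (P : Program) (C : ℕ), ∀ E : Env d 0, 1 ≤ E.size → ∀ s : State,
      HoldsInput E.site E.pr E.query s → Runs (C * E.size) P s (C * E.size ^ k) fun s' =>
        s'.rreg 0 = F { E with param := G { E with param := 0 } } := by
  obtain ⟨PG, KG, hPG⟩ := hG 0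
  obtain ⟨PF, KF, hPF⟩ := hF 0
  refine ⟨.seq (.instr (.wconst 1 1)) (.seq (.instr (.wconst 2 (d + 1)))
    (.seq (.instr (.rconst 0 0)) (.seq PG (.seq (.instr (.rcopy 0 1))
    (.seq PF (.instr (.rcopy 0 1))))))), KG + KF + 2 * d + 5, fun E hE s hs => ?_⟩
  set M := (KG + KF + 2 * d + 5) * E.size with hM
  have hlt : E.size * (d + 1) + d < M := by nlinarith
  have hdM : d + 1 < M := by nlinarith
  let E₀ : Env d 0 := { E with param := 0 }
  let E₁ : Env d 0 := { E with param := G E₀ }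
  have hs₀ : E₀.Loaded M (((s.setW 1 1).setW 2 (d + 1)).setR 0 (0 : ℚ)) :=
    { size_pos := hE
      lt_mem := hlt
      input := ⟨hs.size, hs.site, hs.pr, hs.query⟩
      one := by simp
      stride := by simp
      var := fun i => i.elim0
      param := by simp [E₀] }
  refine Runs.mono (Runs.instr_seq (by simp only [Instr.Ok]; omega) <| Runs.instr_seq hdM <|
    Runs.instr_seq trivial <| (hPG E₀ M _ hs₀).seq fun s₁ ⟨hf, hG₁⟩ =>
    Runs.instr_seq trivial <| (hPF E₁ M _ ?_).seq fun s₂ ⟨_, hF₂⟩ =>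
    Runs.instr trivial (by simpa [Instr.eval] using hF₂)) ?_ fun _ => id
  · have hs₁ := hs₀.frame hf
    exact
      { size_pos := hE
        lt_mem := hlt
        input := ⟨hs₁.input.size, hs₁.input.site, hs₁.input.pr, hs₁.input.query⟩
        one := hs₁.one
        stride := hs₁.stride
        var := hs₁.var
        param := by simp [Instr.eval, hG₁, E₁] }
  · have := Nat.pow_pos (n := k) hE
    nlinarith

end Evaluable

end RealRAM

/-! ### Linear dependences given by minors -/

namespace Unipoint

open Matrix

section Minors

variable {R : Type*} {ι : Type*} {p : ℕ}

/-- The projections of the vectors of the family `w` to their first `k` coordinates. -/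
def leading {k d : ℕ} (h : k ≤ d) (w : ι → Fin d → R) (i : ι) (c : Fin k) : R :=
  w i (Fin.castLE h c)

/-- The projections of the vectors of the family `w` to all but the last two coordinates. -/
abbrev dropTwo (w : ι → Fin (p + 2) → R) : ι → Fin p → R :=
  leading (Nat.le_add_right p 2) w

theorem dropTwo_apply (w : ι → Fin (p + 2) → R) (i : ι) (c : Fin p) :
    dropTwo w i c = w i c.castSucc.castSucc :=
  rfl

variable [CommRing R]

/-- The coefficients, given by Cramer's rule, of a linear dependence between `p + 1` vectors of
`R^p`. -/
def minorCoeff (x : Fin (p + 1) → Fin p → R) (j : Fin (p + 1)) : R :=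
  (-1) ^ (j + p : ℕ) * det (of fun a => x (j.succAbove a))

theorem sum_minorCoeff_mul (x : Fin (p + 1) → Fin p → R) (h : Fin (p + 1) → R) :
    ∑ j, minorCoeff x j * h j = det (of fun j => Fin.snoc (x j) (h j)) := by
  rw [det_succ_column _ (Fin.last p)]
  refine Finset.sum_congr rfl fun j _ => ?_
  have hminor : (of fun j => Fin.snoc (α := fun _ => R) (x j) (h j)).submatrix j.succAbove
      (Fin.last p).succAbove = of fun a => x (j.succAbove a) := by
    ext a c
    simp
  rw [hminor, minorCoeff, mul_right_comm]
  simp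

theorem sum_minorCoeff_smul (x : Fin (p + 1) → Fin p → R) : ∑ j, minorCoeff x j • x j = 0 := by
  ext c
  simp only [Finset.sum_apply, Pi.smul_apply, smul_eq_mul, Pi.zero_apply]
  rw [sum_minorCoeff_mul x fun j => x j c]
  exact det_zero_of_column_eq (Fin.castSucc_ne_last c) fun j => by simp

/-- The dependence of `minorCoeff`, scaled so that its first coefficient is a square. The origin
is a positive combination of `p + 1` real vectors in general position if and only if all these
coefficients are positive. -/
def coneCoeff (x : Fin (p + 1) → Fin p → R) (j : Fin (p + 1)) : R :=
  minorCoeff x 0 * minorCoeff x j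

theorem sum_coneCoeff_smul (x : Fin (p + 1) → Fin p → R) : ∑ j, coneCoeff x j • x j = 0 := by
  simp only [coneCoeff, mul_smul, ← Finset.smul_sum, sum_minorCoeff_smul, smul_zero]

/-- If all `coneCoeff`s are positive, a vector on the ray in which the cone of the vectors `z j`
meets the plane of the last two coordinates. -/
def planeRay (z : Fin (p + 1) → Fin (p + 2) → R) : Fin (p + 2) → R :=
  ∑ j, coneCoeff (dropTwo z) j • z j

theorem planeRay_castSucc_castSucc (z : Fin (p + 1) → Fin (p + 2) → R) (c : Fin p) :
    planeRay z c.castSucc.castSucc = 0 := by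
  rw [planeRay, Finset.sum_apply]
  simpa [dropTwo_apply] using congrFun (sum_coneCoeff_smul (dropTwo z)) c

theorem planeRay_eq_smul_single_add (z : Fin (p + 1) → Fin (p + 2) → R) :
    planeRay z = planeRay z (Fin.last (p + 1)) • Pi.single (Fin.last (p + 1)) 1 +
      planeRay z (Fin.last p).castSucc • Pi.single (Fin.last p).castSucc 1 := by
  rw [pi_eq_sum_univ' (planeRay z), Fin.sum_univ_castSucc, Fin.sum_univ_castSucc]
  simp [planeRay_castSucc_castSucc, add_comm]

/-- A linear functional that vanishes on the vectors `z j`, with a sign that makes it turn always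
in the same sense around the origin of the plane of the last two coordinates. -/
def sideFunctional (z : Fin (p + 1) → Fin (p + 2) → R) : (Fin (p + 2) → R) →ₗ[R] R :=
  minorCoeff (dropTwo z) 0 •
    detRowAlternating.toMultilinearMap.toLinearMap (Fin.snoc z 0) (Fin.last (p + 1))

theorem sideFunctional_apply (z : Fin (p + 1) → Fin (p + 2) → R) (v : Fin (p + 2) → R) :
    sideFunctional z v = minorCoeff (dropTwo z) 0 * det (of (Fin.snoc z v)) := by
  rw [sideFunctional, LinearMap.smul_apply, MultilinearMap.toLinearMap_apply, Fin.update_snoc_last]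
  rfl

theorem sideFunctional_self (z : Fin (p + 1) → Fin (p + 2) → R) (j : Fin (p + 1)) :
    sideFunctional z (z j) = 0 := by
  rw [sideFunctional_apply, det_zero_of_row_eq (Fin.castSucc_ne_last j), mul_zero]
  ext c
  simp

/-- On the plane of the last two coordinates, `sideFunctional z` is the cross product with
`planeRay z`. -/
theorem sideFunctional_of_plane (z : Fin (p + 1) → Fin (p + 2) → R) {v : Fin (p + 2) → R}
    (hv : ∀ c : Fin p, v c.castSucc.castSucc = 0) :
    sideFunctional z v = v (Fin.last (p + 1)) * planeRay z (Fin.last p).castSucc -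
      v (Fin.last p).castSucc * planeRay z (Fin.last (p + 1)) := by
  have hray (c : Fin (p + 2)) : planeRay z c =
      minorCoeff (dropTwo z) 0 * det (of fun j => Fin.snoc (dropTwo z j) (z j c)) := by
    rw [← sum_minorCoeff_mul _ fun j => z j c]
    simp only [planeRay, coneCoeff, Finset.sum_apply, Pi.smul_apply, smul_eq_mul, mul_assoc,
      Finset.mul_sum]
  have hminor_last : (of (Fin.snoc (α := fun _ => Fin (p + 2) → R) z v)).submatrix
      (Fin.last (p + 1)).succAbove (Fin.last (p + 1)).succAbove =
      of fun j => Fin.snoc (dropTwo z j) (z j (Fin.last p).castSucc) := by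
    ext j c
    cases c using Fin.lastCases <;> simp [dropTwo_apply]
  have hminor_castSucc : (of (Fin.snoc (α := fun _ => Fin (p + 2) → R) z v)).submatrix
      (Fin.last (p + 1)).succAbove (Fin.last p).castSucc.succAbove =
      of fun j => Fin.snoc (dropTwo z j) (z j (Fin.last (p + 1))) := by
    ext j c
    cases c using Fin.lastCases <;> simp [dropTwo_apply]
  rw [sideFunctional_apply, hray, hray, det_succ_row _ (Fin.last (p + 1)), Fin.sum_univ_castSucc,
    Fin.sum_univ_castSucc, hminor_last, hminor_castSucc]
  simp [hv]
  ring

end Minors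

/-! ### Positive dependences in general position -/

/-- Any `k` or fewer members of the family `w` of vectors of `𝕜^k` are linearly independent. -/
def LinearGeneralPosition {𝕜 ι : Type*} [Ring 𝕜] {k : ℕ} (w : ι → Fin k → 𝕜) : Prop :=
  ∀ s : Finset ι, s.card ≤ k → LinearIndepOn 𝕜 w s

namespace LinearGeneralPosition

section Ring

variable {𝕜 ι κ : Type*} [Ring 𝕜] {k : ℕ} {w : ι → Fin k → 𝕜}

theorem linearIndependent [Fintype κ] (hw : LinearGeneralPosition w) {f : κ → ι}
    (hf : f.Injective) (hκ : Fintype.card κ ≤ k) : LinearIndependent 𝕜 (w ∘ f) := by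
  rw [← linearIndepOn_range_iff hf]
  simpa using hw (Finset.univ.map ⟨f, hf⟩) (by simpa using hκ)

theorem comp (hw : LinearGeneralPosition w) {f : κ → ι} (hf : f.Injective) :
    LinearGeneralPosition (w ∘ f) := fun s hs =>
  hw.linearIndependent (hf.comp Subtype.val_injective) (by simpa using hs)

end Ring

section Field

variable {𝕜 ι : Type*} [Field 𝕜] {p : ℕ}

theorem span_eq_top {x : Fin (p + 1) → Fin p → 𝕜} (hx : LinearGeneralPosition x) :
    Submodule.span 𝕜 (Set.range x) = ⊤ := by
  have hli := hx.linearIndependent (Fin.succ_injective p) (by simp)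
  rw [eq_top_iff, ← hli.span_eq_top_of_card_eq_finrank' (by simp)]
  exact Submodule.span_mono (Set.range_comp_subset_range _ _)

theorem coeff_ne_zero {x : Fin (p + 1) → Fin p → 𝕜} (hx : LinearGeneralPosition x)
    {μ : Fin (p + 1) → 𝕜} (hμ : ∑ j, μ j • x j = 0) {i : Fin (p + 1)} (hi : μ i ≠ 0)
    (j : Fin (p + 1)) : μ j ≠ 0 := by
  intro hj
  rw [Fin.sum_univ_succAbove _ j, hj, zero_smul, zero_add] at hμ
  have hzero := Fintype.linearIndependent_iff.1
    (hx.linearIndependent j.succAbove_right_injective (by simp)) _ hμ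
  obtain ⟨a, rfl⟩ := Fin.exists_succAbove_eq (ne_of_apply_ne μ (hj.symm ▸ hi))
  exact hi (hzero a)

theorem minorCoeff_ne_zero {x : Fin (p + 1) → Fin p → 𝕜} (hx : LinearGeneralPosition x)
    (j : Fin (p + 1)) : minorCoeff x j ≠ 0 := by
  have hunit : IsUnit (of fun a => x (j.succAbove a)) := linearIndependent_rows_iff_isUnit.1
    (hx.linearIndependent j.succAbove_right_injective (by simp))
  exact mul_ne_zero (by simp) ((isUnit_iff_isUnit_det _).1 hunit).ne_zero

theorem sideFunctional_ne_zero {w : ι → Fin (p + 2) → 𝕜} (hw : LinearGeneralPosition w)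
    (hx : LinearGeneralPosition (dropTwo w)) {f : Fin (p + 1) → ι} (hf : f.Injective) {b : ι}
    (hb : b ∉ Set.range f) : sideFunctional (w ∘ f) (w b) ≠ 0 := by
  have hunit : IsUnit (of (Fin.snoc (w ∘ f) (w b))) := by
    rw [← linearIndependent_rows_iff_isUnit]
    exact Fin.comp_snoc w f b ▸
      hw.linearIndependent (Fin.snoc_injective_iff.2 ⟨hf, hb⟩) (by simp)
  rw [sideFunctional_apply]
  exact mul_ne_zero ((hx.comp hf).minorCoeff_ne_zero 0) ((isUnit_iff_isUnit_det _).1 hunit).ne_zero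

variable [LinearOrder 𝕜] [IsStrictOrderedRing 𝕜]

theorem exists_coneCoeff_eq_mul {x : Fin (p + 1) → Fin p → 𝕜} (hx : LinearGeneralPosition x)
    {μ : Fin (p + 1) → 𝕜} (hμ_pos : ∀ j, 0 < μ j) (hμ : ∑ j, μ j • x j = 0) :
    ∃ τ : 𝕜, 0 < τ ∧ ∀ j, coneCoeff x j = τ * μ j := by
  have hm := hx.minorCoeff_ne_zero 0
  have hμ₀ := hμ_pos 0
  refine ⟨minorCoeff x 0 ^ 2 / μ 0, by positivity, fun j => ?_⟩
  have hsum : ∑ j, (μ 0 * minorCoeff x j - minorCoeff x 0 * μ j) • x j = 0 := by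
    simp only [sub_smul, mul_smul, Finset.sum_sub_distrib, ← Finset.smul_sum, hμ,
      sum_minorCoeff_smul, smul_zero, sub_zero]
  have hprop : μ 0 * minorCoeff x j - minorCoeff x 0 * μ j = 0 := by
    by_contra hj
    exact hx.coeff_ne_zero hsum hj 0 (by ring)
  rw [coneCoeff]
  field_simp
  linear_combination hprop

theorem exists_pos_dependence {x : ι → Fin p → 𝕜} (hx : LinearGeneralPosition x) {B : Set ι}
    (h0 : 0 ∈ convexHull 𝕜 (x '' B)) :
    ∃ (f : Fin (p + 1) → ι) (μ : Fin (p + 1) → 𝕜), f.Injective ∧ (∀ j, f j ∈ B) ∧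
      (∀ j, 0 < μ j) ∧ ∑ j, μ j • x (f j) = 0 := by
  obtain ⟨κ, _, z, ν, hz, hz_aff, hν, hν_sum, hνz⟩ := eq_pos_convex_span_of_mem_convexHull h0
  choose b hbB hb using fun i => hz ⟨i, rfl⟩
  obtain rfl : x ∘ b = z := funext hb
  have hb_inj : b.Injective := hz_aff.injective.of_comp
  have hcard_le : Fintype.card κ ≤ p + 1 := hz_aff.card_le_finrank_succ.trans <| by
    simpa using Submodule.finrank_le (vectorSpan 𝕜 (Set.range (x ∘ b)))
  have hcard : Fintype.card κ = p + 1 := by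
    by_contra hne
    have hν_zero := Fintype.linearIndependent_iff.1
      (hx.linearIndependent hb_inj (by omega)) ν hνz
    simp [hν_zero] at hν_sum
  let e : Fin (p + 1) ≃ κ := (Fintype.equivFinOfCardEq hcard).symm
  refine ⟨b ∘ e, ν ∘ e, hb_inj.comp e.injective, fun j => hbB _, fun j => hν _, ?_⟩
  exact (e.sum_comp fun i => ν i • x (b i)).trans hνz

end Field

end LinearGeneralPosition

/-! ### Positive circuits and extreme facets -/

theorem exists_nonneg_combination {𝕜 κ E : Type*} [Field 𝕜] [LinearOrder 𝕜]
    [IsStrictOrderedRing 𝕜] [Fintype κ] [Nonempty κ] [AddCommGroup E]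
    [Module 𝕜 E] {z : κ → E} {μ : κ → 𝕜} (hμ_pos : ∀ j, 0 < μ j) (hμ : ∑ j, μ j • z j = 0)
    {y : E} (hy : y ∈ Submodule.span 𝕜 (Set.range z)) :
    ∃ c : κ → 𝕜, (∀ j, 0 ≤ c j) ∧ (∃ j₀, c j₀ = 0) ∧ ∑ j, c j • z j = y := by
  obtain ⟨e, he⟩ := (Submodule.mem_span_range_iff_exists_fun 𝕜).1 hy
  obtain ⟨j₀, hj₀⟩ := Finite.exists_min fun j => e j / μ j
  refine ⟨fun j => e j - e j₀ / μ j₀ * μ j, fun j => ?_, ⟨j₀, ?_⟩, ?_⟩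
  · exact sub_nonneg.2 ((le_div_iff₀ (hμ_pos j)).1 (hj₀ j))
  · exact sub_eq_zero_of_eq (div_mul_cancel₀ _ (hμ_pos j₀).ne').symm
  · simp only [sub_smul, mul_smul, Finset.sum_sub_distrib, ← Finset.smul_sum, hμ, he, smul_zero,
      sub_zero]

section Circuit

variable {𝕜 ι : Type*} [Field 𝕜] [LinearOrder 𝕜] [LinearOrder ι] {p : ℕ}

/-- The indices `f 0 < f 1 < ⋯ < f p` in `B` are those of `p + 1` vectors of the family `x` of
which the origin of `𝕜^p` is a positive combination. -/
structure IsPositiveCircuit (x : ι → Fin p → 𝕜) (B : Set ι) (f : Fin (p + 1) → ι) : Prop where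
  strictMono : StrictMono f
  mem : ∀ j, f j ∈ B
  coeff_pos : ∀ j, 0 < coneCoeff (x ∘ f) j

variable [IsStrictOrderedRing 𝕜]

theorem IsPositiveCircuit.zero_mem_convexHull {x : ι → Fin p → 𝕜} {B : Set ι}
    {f : Fin (p + 1) → ι} (hf : IsPositiveCircuit x B f) : 0 ∈ convexHull 𝕜 (x '' B) := by
  have h := Finset.univ.centerMass_mem_convexHull (fun j _ => (hf.coeff_pos j).le)
    (Finset.sum_pos (fun j _ => hf.coeff_pos j) Finset.univ_nonempty)
    (fun j _ => Set.mem_image_of_mem x (hf.mem j))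
  rwa [Finset.centerMass, show ∑ j, coneCoeff (x ∘ f) j • x (f j) = 0 from
    sum_coneCoeff_smul (x ∘ f), smul_zero] at h

theorem exists_perm_isPositiveCircuit {x : ι → Fin p → 𝕜} (hx : LinearGeneralPosition x)
    {B : Set ι} {f : Fin (p + 1) → ι} (hf : f.Injective) (hfB : ∀ j, f j ∈ B)
    {μ : Fin (p + 1) → 𝕜} (hμ_pos : ∀ j, 0 < μ j) (hμ : ∑ j, μ j • x (f j) = 0) :
    ∃ σ : Equiv.Perm (Fin (p + 1)), IsPositiveCircuit x B (f ∘ σ) ∧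
      ∃ τ : 𝕜, 0 < τ ∧ ∀ j, coneCoeff (x ∘ f ∘ σ) j = τ * μ (σ j) := by
  let σ := Tuple.sort f
  have hfσ : (f ∘ σ).Injective := hf.comp σ.injective
  obtain ⟨τ, hτ, hcoeff⟩ := (hx.comp hfσ).exists_coneCoeff_eq_mul (μ := μ ∘ σ)
    (fun j => hμ_pos _) ((Equiv.sum_comp σ fun j => μ j • x (f j)).trans hμ)
  refine ⟨σ, ⟨(Tuple.monotone_sort f).strictMono_of_injective hfσ, fun j => hfB _, fun j => ?_⟩,
    τ, hτ, hcoeff⟩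
  exact hcoeff j ▸ mul_pos hτ (hμ_pos _)

theorem exists_isPositiveCircuit {x : ι → Fin p → 𝕜} (hx : LinearGeneralPosition x)
    {B : Set ι} (h0 : 0 ∈ convexHull 𝕜 (x '' B)) : ∃ f, IsPositiveCircuit x B f := by
  obtain ⟨f, μ, hf, hfB, hμ_pos, hμ⟩ := hx.exists_pos_dependence h0
  obtain ⟨σ, hσ, -⟩ := exists_perm_isPositiveCircuit hx hf hfB hμ_pos hμ
  exact ⟨f ∘ σ, hσ⟩

/-- A pivoting step: `b` replaces one of the indices `f j`. -/
theorem IsPositiveCircuit.exists_sideFunctional_planeRay_neg {w : ι → Fin (p + 2) → 𝕜}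
    {B : Set ι} {f : Fin (p + 1) → ι} (hf : IsPositiveCircuit (dropTwo w) B f)
    (hx : LinearGeneralPosition (dropTwo w)) {b : ι} (hb : b ∈ B)
    (hneg : sideFunctional (w ∘ f) (w b) < 0) :
    ∃ g, IsPositiveCircuit (dropTwo w) B g ∧ sideFunctional (w ∘ f) (planeRay (w ∘ g)) < 0 := by
  have hinj := hf.strictMono.injective
  have hbf : b ∉ Set.range f := by
    rintro ⟨j, rfl⟩
    exact hneg.ne (sideFunctional_self (w ∘ f) j)
  obtain ⟨c, hc, ⟨j₀, hj₀⟩, hcb⟩ := exists_nonneg_combination hf.coeff_pos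
    (sum_coneCoeff_smul (dropTwo w ∘ f)) (y := -dropTwo w b)
    ((hx.comp hinj).span_eq_top ▸ Submodule.mem_top)
  let g : Fin (p + 1) → ι := Fin.cons b (f ∘ j₀.succAbove)
  let ν : Fin (p + 1) → 𝕜 := Fin.cons 1 (c ∘ j₀.succAbove)
  have hsum {q : ℕ} (v : ι → Fin q → 𝕜) : ∑ j, ν j • v (g j) = v b + ∑ j, c j • v (f j) := by
    rw [Fin.sum_univ_succ, Fin.sum_univ_succAbove _ j₀, hj₀]
    simp [ν, g]
  have hg_inj : g.Injective := Fin.cons_injective_iff.2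
    ⟨fun ⟨a, ha⟩ => hbf ⟨_, ha⟩, hinj.comp j₀.succAbove_right_injective⟩
  have hgB : ∀ j, g j ∈ B := Fin.cases hb fun a => hf.mem _
  have hνg : ∑ j, ν j • dropTwo w (g j) = 0 :=
    (hsum (dropTwo w)).trans (add_eq_zero_iff_neg_eq.2 hcb.symm)
  have hν_nonneg : ∀ j, 0 ≤ ν j := Fin.cases zero_le_one fun a => hc _
  have hν₀ : ν 0 ≠ 0 := one_ne_zero (α := 𝕜)
  have hν_pos (j) : 0 < ν j := lt_of_le_of_ne (hν_nonneg j)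
    ((hx.comp hg_inj).coeff_ne_zero hνg hν₀ j).symm
  obtain ⟨σ, hσ, τ, hτ, hcoeff⟩ := exists_perm_isPositiveCircuit hx hg_inj hgB hν_pos hνg
  have hray : planeRay (w ∘ g ∘ σ) = τ • (w b + ∑ j, c j • w (f j)) := by
    rw [← hsum, Finset.smul_sum, ← Equiv.sum_comp σ, planeRay]
    exact Finset.sum_congr rfl fun j _ => by rw [← mul_smul, ← hcoeff]; rfl
  have hside (j) : sideFunctional (w ∘ f) (w (f j)) = 0 := sideFunctional_self (w ∘ f) j
  refine ⟨g ∘ σ, hσ, ?_⟩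
  rw [hray]
  simpa [hside] using mul_neg_of_pos_of_neg hτ hneg

end Circuit

section Facet

variable {𝕜 ι : Type*} [Field 𝕜] [LinearOrder 𝕜] [LinearOrder ι] {p : ℕ}

/-- The vectors `w (f j)` span the extreme facet, in a fixed sense of rotation, of the cone of the
vectors `w b`, `b ∈ B`, among the facets that meet the plane of the last two coordinates. -/
structure IsExtremeFacet (w : ι → Fin (p + 2) → 𝕜) (B : Set ι) (f : Fin (p + 1) → ι) : Prop
    extends IsPositiveCircuit (dropTwo w) B f where
  side_pos : ∀ b ∈ B, b ∉ Set.range f → 0 < sideFunctional (w ∘ f) (w b)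

namespace IsExtremeFacet

variable {w : ι → Fin (p + 2) → 𝕜} {B : Set ι} {f g : Fin (p + 1) → ι}

theorem side_nonneg (hf : IsExtremeFacet w B f) {b : ι} (hb : b ∈ B) :
    0 ≤ sideFunctional (w ∘ f) (w b) := by
  by_cases hbf : b ∈ Set.range f
  · obtain ⟨j, rfl⟩ := hbf
    exact (sideFunctional_self (w ∘ f) j).ge
  · exact (hf.side_pos b hb hbf).le

variable [IsStrictOrderedRing 𝕜]

theorem side_planeRay_pos (hf : IsExtremeFacet w B f) (hg : IsExtremeFacet w B g) (hne : f ≠ g) :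
    0 < sideFunctional (w ∘ f) (planeRay (w ∘ g)) := by
  obtain ⟨i, hi⟩ : ∃ i, g i ∉ Set.range f := by
    by_contra! hsub
    have hrange : Set.range g = Set.range f := Set.eq_of_subset_of_ncard_le
      (Set.range_subset_iff.2 hsub) (by simp [Set.ncard_range_of_injective, hf.strictMono.injective,
        hg.strictMono.injective])
    exact hne ((hf.strictMono.range_inj hg.strictMono).1 hrange.symm)
  simp only [planeRay, map_sum, map_smul, smul_eq_mul]
  exact Finset.sum_pos' (fun j _ => mul_nonneg (hg.coeff_pos j).le (hf.side_nonneg (hg.mem j)))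
    ⟨i, Finset.mem_univ _, mul_pos (hg.coeff_pos i) (hf.side_pos _ (hg.mem i) hi)⟩

/-- Both cross products `planeRay f × planeRay g` and `planeRay g × planeRay f` would be
positive. -/
theorem unique (hf : IsExtremeFacet w B f) (hg : IsExtremeFacet w B g) : f = g := by
  by_contra hne
  have hfg := hf.side_planeRay_pos hg hne
  have hgf := hg.side_planeRay_pos hf (Ne.symm hne)
  rw [sideFunctional_of_plane _ (planeRay_castSucc_castSucc _)] at hfg hgf
  linarith

theorem zero_notMem_convexHull (hf : IsExtremeFacet w B f) (hw : LinearGeneralPosition w) :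
    0 ∉ convexHull 𝕜 (w '' B) := by
  intro h0
  obtain ⟨g, μ, hg, hgB, hμ_pos, hμ⟩ := hw.exists_pos_dependence h0
  have hside : ∑ j, μ j * sideFunctional (w ∘ f) (w (g j)) = 0 := by
    simpa using congrArg (sideFunctional (w ∘ f)) hμ
  rw [Finset.sum_eq_zero_iff_of_nonneg
    fun j _ => mul_nonneg (hμ_pos j).le (hf.side_nonneg (hgB j))] at hside
  have hrange : Set.range g ⊆ Set.range f := by
    rintro _ ⟨j, rfl⟩
    by_contra hj
    exact (mul_pos (hμ_pos j) (hf.side_pos _ (hgB j) hj)).ne' (hside j (Finset.mem_univ j))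
  have hcard := Set.ncard_le_ncard hrange
  simp [Set.ncard_range_of_injective, hg, hf.strictMono.injective] at hcard

end IsExtremeFacet

end Facet

theorem exists_forall_cross_nonneg {α 𝕜 : Type*} [Field 𝕜] [LinearOrder 𝕜]
    [IsStrictOrderedRing 𝕜] {S : Set α} (hS : S.Finite) (hS' : S.Nonempty) (x y : α → 𝕜) {u v : 𝕜}
    (h : ∀ i ∈ S, 0 < x i * u + y i * v) : ∃ i ∈ S, ∀ j ∈ S, 0 ≤ x j * y i - y j * x i := by
  obtain ⟨i, hi, hmax⟩ := Set.exists_max_image S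
    (fun i => (y i * u - x i * v) / (x i * u + y i * v)) hS hS'
  refine ⟨i, hi, fun j hj => ?_⟩
  have hcross : 0 ≤ (u * u + v * v) * (x j * y i - y j * x i) := by
    have := (div_le_div_iff₀ (h j hj) (h i hi)).1 (hmax j hj)
    linarith
  have hne : u * u + v * v ≠ 0 := by
    rw [Ne, mul_self_add_mul_self_eq_zero]
    rintro ⟨rfl, rfl⟩
    simpa using h i hi
  exact nonneg_of_mul_nonneg_right hcross
    (lt_of_le_of_ne (add_nonneg (mul_self_nonneg u) (mul_self_nonneg v)) hne.symm)

theorem exists_dual_pos_of_zero_notMem_convexHull {E : Type*} [AddCommGroup E] [Module ℝ E]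
    [TopologicalSpace E] [IsTopologicalAddGroup E] [ContinuousSMul ℝ E] [LocallyConvexSpace ℝ E]
    [T2Space E] {s : Set E} (hs : s.Finite) (h0 : 0 ∉ convexHull ℝ s) :
    ∃ ℓ : StrongDual ℝ E, ∀ x ∈ s, 0 < ℓ x := by
  obtain ⟨ℓ, u, hu, hℓ⟩ :=
    geometric_hahn_banach_point_closed (convex_convexHull ℝ s) (hs.isClosed_convexHull (𝕜 := ℝ)) h0
  rw [map_zero] at hu
  exact ⟨ℓ, fun x hx => hu.trans (hℓ x (subset_convexHull ℝ s hx))⟩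

/-- The circuit whose ray is extreme in the half plane where `ℓ` is positive spans a facet, for a
vector `w b` on the wrong side of it would pivot into a circuit with a ray on the wrong side. -/
theorem exists_isExtremeFacet {ι : Type*} [LinearOrder ι] {p : ℕ} {w : ι → Fin (p + 2) → ℝ}
    {B : Set ι} (hB : B.Finite) (hw : LinearGeneralPosition w)
    (hx : LinearGeneralPosition (dropTwo w)) (h0 : 0 ∈ convexHull ℝ (dropTwo w '' B))
    (h : 0 ∉ convexHull ℝ (w '' B)) : ∃ f, IsExtremeFacet w B f := by
  obtain ⟨ℓ, hℓ⟩ := exists_dual_pos_of_zero_notMem_convexHull (hB.image w) h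
  let S : Set (Fin (p + 1) → ι) := {f | IsPositiveCircuit (dropTwo w) B f}
  have hS : S.Finite := (Set.Finite.pi' fun _ => hB).subset fun f hf => hf.mem
  have hray (f) (hf : f ∈ S) : 0 < ℓ (planeRay (w ∘ f)) := by
    simp only [planeRay, map_sum, map_smul, smul_eq_mul]
    exact Finset.sum_pos (fun j _ => mul_pos (hf.coeff_pos j)
      (hℓ _ (Set.mem_image_of_mem w (hf.mem j)))) Finset.univ_nonempty
  obtain ⟨f, hf, hmax⟩ := exists_forall_cross_nonneg hS (exists_isPositiveCircuit hx h0)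
    (fun f => planeRay (w ∘ f) (Fin.last (p + 1))) (fun f => planeRay (w ∘ f) (Fin.last p).castSucc)
    (u := ℓ (Pi.single (Fin.last (p + 1)) 1)) (v := ℓ (Pi.single (Fin.last p).castSucc 1))
    fun f hf => by
      have := hray f hf
      rwa [planeRay_eq_smul_single_add, map_add, map_smul, map_smul] at this
  refine ⟨f, hf, fun b hb hbf => ?_⟩
  by_contra hneg
  obtain ⟨g, hg, hgneg⟩ := hf.exists_sideFunctional_planeRay_neg hx hb
    (lt_of_le_of_ne (not_lt.1 hneg) (hw.sideFunctional_ne_zero hx hf.strictMono.injective hbf))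
  rw [sideFunctional_of_plane _ (planeRay_castSucc_castSucc _)] at hgneg
  exact (hmax g hg).not_gt hgneg

/-! ### The probability of avoiding the origin -/

theorem sum_outcomeProb_filter {n : ℕ} (pr : Fin n → ℝ) (a b : Fin n → Prop) [DecidablePred a]
    [DecidablePred b] [DecidablePred fun B : Finset (Fin n) => (∀ i ∈ B, a i) ∧ ∀ i ∉ B, b i] :
    ∑ B with (∀ i ∈ B, a i) ∧ ∀ i ∉ B, b i, outcomeProb pr B =
      ∏ i, ((if a i then pr i else 0) + if b i then 1 - pr i else 0) := by
  rw [Finset.prod_add, Finset.powerset_univ, Finset.sum_filter]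
  refine Finset.sum_congr rfl fun B _ => ?_
  rw [Finset.prod_ite_zero, ← Finset.compl_eq_univ_sdiff, Finset.prod_ite_zero,
    ite_zero_mul_ite_zero, outcomeProb]
  simp only [Finset.mem_compl]

theorem sum_outcomeProb_filter_forall_mem {n : ℕ} (pr : Fin n → ℝ) (a : Fin n → Prop)
    [DecidablePred a] [DecidablePred fun B : Finset (Fin n) => ∀ i ∈ B, a i] :
    ∑ B with ∀ i ∈ B, a i, outcomeProb pr B = ∏ i, if a i then 1 else 1 - pr i := by
  classical
  have h := sum_outcomeProb_filter pr a fun _ => True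
  simp only [implies_true, and_true, if_true] at h
  convert h using 3 with i
  split_ifs <;> ring

theorem sum_outcomeProb {n : ℕ} (pr : Fin n → ℝ) : ∑ B, outcomeProb pr B = 1 := by
  simpa using sum_outcomeProb_filter_forall_mem pr fun _ => True

section AvoidProb

variable {E F : Type*} [AddCommGroup E] [Module ℝ E] [AddCommGroup F] [Module ℝ F] {n : ℕ}

open Classical in
/-- The probability that the origin is not in the convex hull of the existing vectors. -/
noncomputable def avoidProb (w : Fin n → E) (pr : Fin n → ℝ) : ℝ :=
  ∑ B ∈ Finset.univ.filter
    (fun B : Finset (Fin n) => 0 ∉ convexHull ℝ (w '' (B : Set (Fin n)))), outcomeProb pr B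

theorem avoidProb_comp_linearMap (φ : E →ₗ[ℝ] F) (hφ : Function.Injective φ) (w : Fin n → E)
    (pr : Fin n → ℝ) : avoidProb (φ ∘ w) pr = avoidProb w pr := by
  classical
  have hmem (s : Set (Fin n)) :
      0 ∈ convexHull ℝ (φ ∘ w '' s) ↔ 0 ∈ convexHull ℝ (w '' s) := by
    rw [Set.image_comp, ← φ.image_convexHull, ← map_zero φ, hφ.mem_set_image]
  simp only [avoidProb, hmem]

theorem membershipProb_eq_one_sub_avoidProb {d : ℕ} (site : Fin n → Fin d → ℝ) (pr : Fin n → ℝ)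
    (q : Fin d → ℝ) : membershipProb site pr q = 1 - avoidProb (fun i => site i - q) pr := by
  classical
  have hmem (s : Set (Fin n)) :
      q ∈ convexHull ℝ (site '' s) ↔ 0 ∈ convexHull ℝ ((fun i => site i - q) '' s) := by
    let τ : (Fin d → ℝ) →ᵃ[ℝ] Fin d → ℝ := (AffineEquiv.vaddConst ℝ q).symm
    have hτ : τ q = 0 := sub_self q
    have hτ_inj : Function.Injective τ := sub_left_injective
    rw [show (fun i => site i - q) = τ ∘ site from rfl, Set.image_comp, ← τ.image_convexHull, ← hτ,
      hτ_inj.mem_set_image]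
  simp only [membershipProb, avoidProb, hmem]
  rw [← sum_outcomeProb pr, eq_sub_iff_add_eq, Finset.sum_filter_add_sum_filter_not]

theorem avoidProb_of_subsingleton [Subsingleton E] (w : Fin n → E) (pr : Fin n → ℝ) :
    avoidProb w pr = ∏ i, (1 - pr i) := by
  classical
  have hmem (B : Finset (Fin n)) : 0 ∉ convexHull ℝ (w '' B) ↔ B = ∅ := by
    rw [Subsingleton.mem_iff_nonempty, convexHull_nonempty_iff, Set.image_nonempty,
      Finset.coe_nonempty, Finset.not_nonempty_iff_eq_empty]
  simp only [avoidProb, hmem]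
  simp [outcomeProb, Finset.filter_eq']

theorem zero_notMem_convexHull_image_iff {ι : Type*} {r : ι → ℝ} {s : Set ι} :
    0 ∉ convexHull ℝ (r '' s) ↔ (∀ i ∈ s, 0 < r i) ∨ ∀ i ∈ s, r i < 0 := by
  refine ⟨fun h => ?_, ?_⟩
  · by_contra! hsign
    obtain ⟨⟨i, hi, hri⟩, j, hj, hrj⟩ := hsign
    exact h ((convex_convexHull ℝ (r '' s)).ordConnected.out
      (subset_convexHull ℝ _ (Set.mem_image_of_mem r hi))
      (subset_convexHull ℝ _ (Set.mem_image_of_mem r hj)) ⟨hri, hrj⟩)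
  · rintro (hpos | hneg) h
    · exact lt_irrefl (0 : ℝ) (convexHull_min (t := Set.Ioi 0)
      (Set.image_subset_iff.2 fun i => hpos i) (convex_Ioi 0) h)
    · exact lt_irrefl (0 : ℝ) (convexHull_min (t := Set.Iio 0)
      (Set.image_subset_iff.2 fun i => hneg i) (convex_Iio 0) h)

theorem avoidProb_real (r pr : Fin n → ℝ) :
    avoidProb r pr = (∏ i, if 0 < r i then 1 else 1 - pr i) +
      (∏ i, if r i < 0 then 1 else 1 - pr i) - ∏ i, (1 - pr i) := by
  classical
  have hboth : ({B | ∀ i ∈ B, 0 < r i} : Finset (Finset (Fin n))) ∩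
      ({B | ∀ i ∈ B, r i < 0} : Finset (Finset (Fin n))) = {∅} := by
    ext B
    simp only [Finset.mem_inter, Finset.mem_filter_univ, Finset.mem_singleton]
    refine ⟨fun h => Finset.eq_empty_of_forall_notMem fun i hi => ?_, ?_⟩
    · exact (h.1 i hi).not_gt (h.2 i hi)
    · rintro rfl
      simp
  have hempty : ∏ i, (1 - pr i) = ∑ B ∈ {∅}, outcomeProb pr B := by simp [outcomeProb]
  simp only [avoidProb, zero_notMem_convexHull_image_iff, Finset.mem_coe]
  rw [Finset.filter_or, eq_sub_iff_add_eq, hempty, ← hboth, Finset.sum_union_inter,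
    sum_outcomeProb_filter_forall_mem, sum_outcomeProb_filter_forall_mem]

end AvoidProb

section FacetProb

variable {n p : ℕ}

open Classical in
/-- The probability that the existing vectors have the extreme facet `f`. -/
noncomputable def facetProb (w : Fin n → Fin (p + 2) → ℝ) (pr : Fin n → ℝ)
    (f : Fin (p + 1) → Fin n) : ℝ :=
  ∑ B ∈ Finset.univ.filter (fun B : Finset (Fin n) => IsExtremeFacet w (B : Set (Fin n)) f),
    outcomeProb pr B

open Classical in
theorem facetProb_eq (w : Fin n → Fin (p + 2) → ℝ) (pr : Fin n → ℝ) (f : Fin (p + 1) → Fin n) :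
    facetProb w pr f = if StrictMono f ∧ ∀ j, 0 < coneCoeff (dropTwo w ∘ f) j then
      ∏ i, if ∃ j, f j = i then pr i else if 0 < sideFunctional (w ∘ f) (w i) then 1 else 1 - pr i
      else 0 := by
  split_ifs with hf
  · have hfacet (B : Finset (Fin n)) : IsExtremeFacet w (B : Set (Fin n)) f ↔
        (∀ i ∈ B, (∃ j, f j = i) ∨ 0 < sideFunctional (w ∘ f) (w i)) ∧ ∀ i ∉ B, ¬∃ j, f j = i := by
      refine ⟨fun h => ⟨fun i hi => or_iff_not_imp_left.2 (h.side_pos i hi), ?_⟩,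
        fun h => ⟨⟨hf.1, fun j => not_not.1 fun hj => h.2 _ hj ⟨j, rfl⟩, hf.2⟩,
          fun i hi => (h.1 i hi).resolve_left⟩⟩
      rintro _ hi ⟨j, rfl⟩
      exact hi (h.mem j)
    simp only [facetProb, hfacet]
    rw [sum_outcomeProb_filter]
    refine Finset.prod_congr rfl fun i _ => ?_
    by_cases hi : ∃ j, f j = i <;> by_cases hpos : 0 < sideFunctional (w ∘ f) (w i) <;>
      simp [hi, hpos]
  · rw [facetProb, Finset.filter_false_of_mem fun B _ h => hf ⟨h.strictMono, h.coeff_pos⟩,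
      Finset.sum_empty]

theorem avoidProb_eq_sum_facetProb_add {w : Fin n → Fin (p + 2) → ℝ}
    (hw : LinearGeneralPosition w) (hx : LinearGeneralPosition (dropTwo w)) (pr : Fin n → ℝ) :
    avoidProb w pr = ∑ f, facetProb w pr f + avoidProb (dropTwo w) pr := by
  classical
  have hdrop {s : Set (Fin n)} (h0 : 0 ∈ convexHull ℝ (w '' s)) :
      0 ∈ convexHull ℝ (dropTwo w '' s) := by
    let φ := LinearMap.funLeft ℝ ℝ (Fin.castLE (Nat.le_add_right p 2))
    rw [show dropTwo w = φ ∘ w from rfl, Set.image_comp, ← φ.image_convexHull]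
    exact ⟨0, h0, map_zero φ⟩
  have hindicator (B : Finset (Fin n)) :
      (if 0 ∉ convexHull ℝ (w '' (B : Set (Fin n))) then outcomeProb pr B else 0) =
        (∑ f, if IsExtremeFacet w (B : Set (Fin n)) f then outcomeProb pr B else 0) +
          if 0 ∉ convexHull ℝ (dropTwo w '' (B : Set (Fin n))) then outcomeProb pr B else 0 := by
    by_cases hfacet : ∃ f, IsExtremeFacet w (B : Set (Fin n)) f
    · obtain ⟨f, hf⟩ := hfacet
      rw [if_pos (hf.zero_notMem_convexHull hw), if_neg (not_not.2 hf.zero_mem_convexHull),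
        Finset.sum_eq_single f (fun g _ hgf => if_neg fun hg => hgf (hg.unique hf)) (by simp),
        if_pos hf, add_zero]
    · have hiff : 0 ∈ convexHull ℝ (w '' (B : Set (Fin n))) ↔
          0 ∈ convexHull ℝ (dropTwo w '' (B : Set (Fin n))) := ⟨hdrop, fun h0 => not_not.1
            fun h => hfacet (exists_isExtremeFacet B.finite_toSet hw hx h0 h)⟩
      push Not at hfacet
      simp only [hiff, hfacet, if_false, Finset.sum_const_zero, zero_add]
  simp only [avoidProb, facetProb, Finset.sum_filter, hindicator, Finset.sum_add_distrib]
  rw [Finset.sum_comm]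

theorem avoidProb_fin_one (w : Fin n → Fin 1 → ℝ) (pr : Fin n → ℝ) :
    avoidProb w pr = (∏ i, if 0 < w i 0 then 1 else 1 - pr i) +
      (∏ i, if w i 0 < 0 then 1 else 1 - pr i) - ∏ i, (1 - pr i) := by
  rw [← avoidProb_real]
  exact (avoidProb_comp_linearMap (LinearMap.proj 0 : (Fin 1 → ℝ) →ₗ[ℝ] ℝ)
    (LinearEquiv.funUnique (Fin 1) ℝ ℝ).injective w pr).symm

end FacetProb

/-! ### Shearing into general position -/

/-- For all `k ≥ 2`, any `k` of the vectors of the family `w` are linearly independent after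
projection to their first `k` coordinates. -/
def LeadingGeneralPosition {𝕜 ι : Type*} [Ring 𝕜] {d : ℕ} (w : ι → Fin d → 𝕜) : Prop :=
  ∀ k, 2 ≤ k → ∀ (hk : k ≤ d) (s : Finset ι), s.card = k → LinearIndepOn 𝕜 (leading hk w) s

theorem LeadingGeneralPosition.linearGeneralPosition_leading {𝕜 ι : Type*} [Ring 𝕜] [Finite ι]
    [Nontrivial ι] {d k : ℕ} {w : ι → Fin d → 𝕜} (hw : LeadingGeneralPosition w) (hk₂ : 2 ≤ k)
    (hk : k ≤ d) : LinearGeneralPosition (leading hk w) := by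
  intro s hs
  obtain ⟨t, hst, ht₂, htk⟩ : ∃ t, s ⊆ t ∧ 2 ≤ t.card ∧ t.card ≤ k := by
    have := Fintype.ofFinite ι
    obtain hs₂ | hs₂ := le_total 2 s.card
    · exact ⟨s, subset_rfl, hs₂, hs⟩
    · obtain ⟨t, hst, -, ht⟩ := Finset.exists_subsuperset_card_eq s.subset_univ hs₂
        (Finset.card_univ (α := ι) ▸ Fintype.one_lt_card)
      exact ⟨t, hst, ht.ge, ht.trans_le hk₂⟩
  have hli := hw _ ht₂ (htk.trans hk) t rfl
  exact (LinearIndepOn.of_comp (v := leading hk w) (LinearMap.funLeft 𝕜 𝕜 (Fin.castLE htk))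
    hli).mono (Finset.coe_subset.2 hst)

theorem GeneralPosition.leadingGeneralPosition {n d : ℕ} {site : Fin n → Fin d → ℝ} {q : Fin d → ℝ}
    (h : GeneralPosition (withQuery site q)) : LeadingGeneralPosition fun i => site i - q := by
  intro k hk₂ hk s hs
  by_contra hdep
  let e : Fin k ≃ s := (Finset.equivFinOfCardEq hs).symm
  let A : Matrix (Fin k) (Fin k) ℝ := of fun j => leading hk (fun i => site i - q) (e j)
  have hA : ¬IsUnit A := fun hA =>
    hdep ((linearIndependent_equiv e).1 (linearIndependent_rows_iff_isUnit.2 hA))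
  rw [isUnit_iff_isUnit_det, isUnit_iff_ne_zero, not_not] at hA
  obtain ⟨a, ha, hAa⟩ := exists_mulVec_eq_zero_iff.2 hA
  let points : Fin (k + 1) ↪ Option (Fin n) :=
    ⟨Fin.cons none fun j => some (e j : Fin n), Fin.cons_injective_iff.2
      ⟨by simp, (Option.some_injective _).comp (Subtype.val_injective.comp e.injective)⟩⟩
  refine h k hk₂ hk (Fin.castLEEmb hk) points a (∑ c, a c * q (Fin.castLE hk c)) ha
    (Fin.cases rfl fun j => ?_)
  have hj : ∑ c, (site (e j) (Fin.castLE hk c) - q (Fin.castLE hk c)) * a c = 0 := congrFun hAa j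
  rw [← sub_eq_zero, ← hj, ← Finset.sum_sub_distrib]
  exact Finset.sum_congr rfl fun c _ => by rw [← mul_sub, mul_comm]; rfl

section Shear

variable {R : Type*} [CommRing R] {p : ℕ}

/-- The shear that adds `t` times the second coordinate to the first one. -/
def shear (t : R) : (Fin (p + 2) → R) ≃ₗ[R] (Fin (p + 2) → R) :=
  LinearEquiv.transvection (f := t • LinearMap.proj 1) (v := Pi.single 0 1) (by simp)

theorem shear_apply (t : R) (v : Fin (p + 2) → R) (c : Fin (p + 2)) :
    shear t v c = v c + if c = 0 then t * v 1 else 0 := by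
  rw [shear, LinearEquiv.transvection.apply]
  simp [Pi.single_apply]

theorem leading_shear_comp {ι : Type*} {m : ℕ} (h : m + 2 ≤ p + 2) (t : R)
    (w : ι → Fin (p + 2) → R) : leading h (shear t ∘ w) = shear t ∘ leading h w := by
  ext i c
  have h0 : Fin.castLE h c = 0 ↔ c = 0 := Fin.castLE_injective h |>.eq_iff' rfl
  simp only [leading, Function.comp_apply, shear_apply, h0]
  rfl

theorem LeadingGeneralPosition.linearGeneralPosition_leading_shear {𝕜 ι : Type*} [Field 𝕜]
    [Finite ι] [Nontrivial ι] {w : ι → Fin (p + 2) → 𝕜} (hw : LeadingGeneralPosition w) {t : 𝕜}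
    (ht : ∀ i, w i 0 + t * w i 1 ≠ 0) :
    ∀ {k : ℕ} (hk : k ≤ p + 2), LinearGeneralPosition (leading hk (shear t ∘ w))
  | 0, _, s, hs => by simp [Finset.card_eq_zero.1 (Nat.le_zero.1 hs)]
  | 1, hk, s, hs => by
    obtain ⟨i, hi⟩ := Finset.card_le_one_iff_subset_singleton.1 hs
    have hne : leading hk (shear t ∘ w) i ≠ 0 := fun h =>
      ht i ((shear_apply t (w i) 0).symm.trans (congrFun h 0))
    exact (LinearIndepOn.singleton hne).mono (mod_cast hi)
  | m + 2, hk, s, hs => by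
    rw [leading_shear_comp]
    exact (hw.linearGeneralPosition_leading (by omega) hk s hs).map_injOn (shear t).toLinearMap
      (shear t).injective.injOn

end Shear

/-- A shear parameter for which no vector of `w` in general position is mapped to a vector with
first coordinate `0`: it is larger than all `|w i 0 / w i 1|`. -/
def shearParam {𝕜 : Type*} [Field 𝕜] {n p : ℕ} (w : Fin n → Fin (p + 2) → 𝕜) : 𝕜 :=
  1 + ∑ i, w i 0 / w i 1 * (w i 0 / w i 1)

theorem LeadingGeneralPosition.add_shearParam_mul_ne_zero {𝕜 : Type*} [Field 𝕜] [LinearOrder 𝕜]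
    [IsStrictOrderedRing 𝕜] {n p : ℕ} [Nontrivial (Fin n)] {w : Fin n → Fin (p + 2) → 𝕜}
    (hw : LeadingGeneralPosition w) (i : Fin n) : w i 0 + shearParam w * w i 1 ≠ 0 := by
  have hw₂ : leading (Nat.le_add_left 2 p) w i ≠ 0 :=
    (hw.linearGeneralPosition_leading le_rfl _ {i} (by simp)).ne_zero (by simp)
  by_cases hy : w i 1 = 0
  · intro hx
    rw [hy, mul_zero, add_zero] at hx
    exact hw₂ (funext (Fin.forall_fin_two.2 ⟨hx, hy⟩))
  · have hsq : w i 0 / w i 1 * (w i 0 / w i 1) ≤ shearParam w - 1 := by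
      rw [shearParam, add_sub_cancel_left]
      exact Finset.single_le_sum (f := fun i => w i 0 / w i 1 * (w i 0 / w i 1))
        (fun i _ => mul_self_nonneg _) (Finset.mem_univ i)
    have hpos : 0 < w i 0 / w i 1 + shearParam w := by
      nlinarith [mul_self_nonneg (w i 0 / w i 1 + 1)]
    rw [← div_mul_cancel₀ (w i 0) hy, ← add_mul]
    exact mul_ne_zero hpos.ne' hy

section AvoidSum

variable {n : ℕ}

/-- The value of `avoidProb w pr` for vectors in general position, computed by dropping the last two
coordinates as often as possible. -/
noncomputable def avoidSum (pr : Fin n → ℝ) : {k : ℕ} → (Fin n → Fin k → ℝ) → ℝ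
  | 0, w => avoidProb w pr
  | 1, w => avoidProb w pr
  | _ + 2, w => ∑ f, facetProb w pr f + avoidSum pr (dropTwo w)

theorem avoidProb_eq_avoidSum (pr : Fin n → ℝ) : ∀ {k : ℕ} (w : Fin n → Fin k → ℝ),
    (∀ {l : ℕ} (hl : l ≤ k), LinearGeneralPosition (leading hl w)) → avoidProb w pr = avoidSum pr w
  | 0, _, _ => rfl
  | 1, _, _ => rfl
  | _ + 2, w, hw => by
    rw [avoidSum, avoidProb_eq_sum_facetProb_add (w := w) (hw le_rfl) (hw _),
      avoidProb_eq_avoidSum pr (dropTwo w) fun hl => hw (hl.trans (Nat.le_add_right _ 2))]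

theorem membershipProb_eq_one_sub_avoidSum [Nontrivial (Fin n)] {p : ℕ}
    {site : Fin n → Fin (p + 2) → ℝ} {q : Fin (p + 2) → ℝ} (pr : Fin n → ℝ)
    (h : LeadingGeneralPosition fun i => site i - q) : membershipProb site pr q =
      1 - avoidSum pr (shear (shearParam fun i => site i - q) ∘ fun i => site i - q) := by
  rw [membershipProb_eq_one_sub_avoidProb, ← avoidProb_eq_avoidSum pr _
    (h.linearGeneralPosition_leading_shear h.add_shearParam_mul_ne_zero)]
  exact congrArg (1 - ·)
    (avoidProb_comp_linearMap (shear _).toLinearMap (shear _).injective _ _).symm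

theorem membershipProb_fin_one {d : ℕ} (site : Fin 1 → Fin d → ℝ) (pr : Fin 1 → ℝ)
    (q : Fin d → ℝ) [Decidable (site 0 = q)] :
    membershipProb site pr q = if site 0 = q then pr 0 else 0 := by
  classical
  have huniv : (Finset.univ : Finset (Finset (Fin 1))) = {∅, {0}} := by decide
  rw [membershipProb, Finset.sum_filter, huniv, Finset.sum_pair (by decide)]
  have hcompl : ({0} : Finset (Fin 1))ᶜ = ∅ := by decide
  simp [outcomeProb, hcompl, eq_comm]

end AvoidSum

end Unipoint

/-! ### Evaluating the membership probability -/

namespace RealRAM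

open Unipoint

namespace Env

variable {e a : ℕ}

/-- The vectors from the query point to the sites. -/
def offset (E : Env (e + 2) a) (i : Fin E.size) : Fin (e + 2) → ℝ :=
  E.site i - E.query

/-- The vectors of `E.offset`, sheared by the auxiliary real parameter of `E`. -/
def sheared (E : Env (e + 2) a) : Fin E.size → Fin (e + 2) → ℝ :=
  shear E.param ∘ E.offset

theorem offset_push (E : Env (e + 2) a) (i : Fin E.size) : (E.push i).offset = E.offset :=
  rfl

theorem sheared_push (E : Env (e + 2) a) (i : Fin E.size) : (E.push i).sheared = E.sheared :=
  rfl

end Env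

variable {e a k : ℕ}

theorem Evaluable.offset (k : ℕ) (i : Fin a) (c : Fin (e + 2)) :
    Evaluable k fun E : Env (e + 2) a => E.offset (E.var i) c :=
  .sub (.coord k i c) (.query k c)

theorem Evaluable.sheared (k : ℕ) (i : Fin a) (c : Fin (e + 2)) :
    Evaluable k fun E : Env (e + 2) a => E.sheared (E.var i) c := by
  simp only [Env.sheared, Function.comp_apply, shear_apply]
  refine .add (.offset k i c) ?_
  split_ifs
  · exact .mul (.param k) (.offset k i 1)
  · exact .zero k

protected theorem Evaluable.shearParam :
    Evaluable 1 fun E : Env (e + 2) a => shearParam E.offset := by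
  have hratio : Evaluable 0 fun E : Env (e + 2) (a + 1) =>
      E.offset (E.var (Fin.last a)) 0 / E.offset (E.var (Fin.last a)) 1 :=
    .div (.offset 0 _ 0) (.offset 0 _ 1)
  refine .add (.one 1) ?_
  simpa only [Env.push_var_last, Env.offset_push] using (Evaluable.mul hratio hratio).sum

protected theorem Evaluable.minorCoeff {p : ℕ} {x : Env (e + 2) a → Fin (p + 1) → Fin p → ℝ}
    (hx : ∀ j c, Evaluable k fun E => x E j c) (j : Fin (p + 1)) :
    Evaluable k fun E => minorCoeff (x E) j :=
  .mul (by simpa using Evaluable.const k ((-1) ^ (j + p : ℕ))) (.det fun _ _ => hx _ _)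

protected theorem Evaluable.coneCoeff {p : ℕ} {x : Env (e + 2) a → Fin (p + 1) → Fin p → ℝ}
    (hx : ∀ j c, Evaluable k fun E => x E j c) (j : Fin (p + 1)) :
    Evaluable k fun E => coneCoeff (x E) j :=
  .mul (.minorCoeff hx 0) (.minorCoeff hx j)

protected theorem Evaluable.sideFunctional {p : ℕ}
    {z : Env (e + 2) a → Fin (p + 1) → Fin (p + 2) → ℝ} {v : Env (e + 2) a → Fin (p + 2) → ℝ}
    (hz : ∀ j c, Evaluable k fun E => z E j c) (hv : ∀ c, Evaluable k fun E => v E c) :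
    Evaluable k fun E => sideFunctional (z E) (v E) := by
  simp only [sideFunctional_apply]
  refine .mul (.minorCoeff (fun _ _ => hz _ _) 0) (.det fun i c => ?_)
  cases i using Fin.lastCases
  · simpa using hv c
  · simpa using hz _ c

theorem Checkable.strictMono_var {d p : ℕ} (k : ℕ) :
    Checkable k fun E : Env d (p + 1) => StrictMono E.var := by
  simp only [Fin.strictMono_iff_lt_succ]
  exact .forall fun i => .var_lt k i.castSucc i.succ

protected theorem Evaluable.facetProb {p : ℕ} (h : p + 2 ≤ e + 2) :
    Evaluable 1 fun E : Env (e + 2) (p + 1) => facetProb (leading h E.sheared) E.pr E.var := by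
  classical
  simp only [facetProb_eq]
  have hx (j : Fin (p + 1)) (c : Fin p) : Evaluable 1 fun E : Env (e + 2) (p + 1) =>
      (dropTwo (leading h E.sheared) ∘ E.var) j c := .sheared 1 j _
  refine .ite (.and (.strictMono_var 1) (.forall fun j => .pos (.coneCoeff hx j))) ?_ (.zero 1)
  have hside : Evaluable 0 fun E : Env (e + 2) (p + 2) => sideFunctional
      (leading h E.sheared ∘ fun j => E.var (Fin.castSucc j))
      (leading h E.sheared (E.var (Fin.last (p + 1)))) :=
    .sideFunctional (fun _ _ => .sheared 0 _ _) (fun _ => .sheared 0 _ _)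
  have hprob := Evaluable.prob (d := e + 2) 0 (Fin.last (p + 1))
  have hprod := Evaluable.prod <| .ite (.exists fun j : Fin (p + 1) =>
    .var_eq 0 j.castSucc (Fin.last (p + 1))) hprob (.ite (.pos hside) (.one 0)
      (.sub (.one 0) hprob))
  simp only [Env.pr_push, Env.push_var_last, Env.push_var_castSucc, Env.sheared_push] at hprod
  convert hprod <;> rfl

theorem Evaluable.prod_ite_one {p : Env d 1 → Prop} [DecidablePred p] (hp : Checkable 0 p) :
    Evaluable 1 fun E : Env d 0 => ∏ i, if p (E.push i) then 1 else 1 - E.pr i := by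
  have hprod := (Evaluable.ite hp (.one 0) (.sub (.one 0) (.prob 0 (Fin.last 0)))).prod
  simpa only [Env.pr_push, Env.push_var_last] using hprod

theorem Evaluable.prod_one_sub_pr :
    Evaluable 1 fun E : Env d 0 => ∏ i, (1 - E.pr i) := by
  simpa only [Env.pr_push, Env.push_var_last] using
    (Evaluable.sub (.one 0) (.prob 0 (Fin.last 0))).prod

protected theorem Evaluable.avoidSum : ∀ {l : ℕ} (h : l ≤ e + 2),
    Evaluable (max 1 l) fun E : Env (e + 2) 0 => avoidSum E.pr (leading h E.sheared)
  | 0, h => by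
    simp only [avoidSum, avoidProb_of_subsingleton]
    exact .prod_one_sub_pr
  | 1, h => by
    have hr : Evaluable 0 fun E : Env (e + 2) 1 => E.sheared (E.var (Fin.last 0)) 0 :=
      .sheared 0 _ 0
    have hsub := Evaluable.sub (.add (.prod_ite_one (.pos hr))
      (.prod_ite_one (.lt hr (.zero 0)))) .prod_one_sub_pr
    simp only [Env.push_var_last] at hsub
    simp only [avoidSum, avoidProb_fin_one]
    exact hsub
  | p + 2, h => by
    have hfacets : Evaluable (max 1 (p + 2)) fun E : Env (e + 2) 0 =>
        ∑ f, facetProb (leading h E.sheared) E.pr f :=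
      (Evaluable.sum_pi (Evaluable.facetProb h)).mono (by omega)
    exact hfacets.add ((Evaluable.avoidSum (Nat.le_of_add_right_le h)).mono (by omega))

theorem Checkable.site_eq_query (k : ℕ) (i : Fin a) :
    Checkable k fun E : Env (e + 2) a => E.site (E.var i) = E.query := by
  simp only [funext_iff]
  exact .forall fun c => .eq (.coord k i c) (.query k c)

open Classical in
/-- The membership probability as the program computes it. General position says nothing about
a single site, which is therefore compared with the query point. -/
noncomputable def Env.membershipFormula (E : Env (e + 2) 0) : ℝ :=
  if E.size = 1 then ∑ i, if E.site i = E.query then E.pr i else 0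
  else 1 - avoidSum E.pr E.sheared

theorem Evaluable.membershipFormula :
    Evaluable (e + 2) fun E : Env (e + 2) 0 => E.membershipFormula := by
  classical
  have hsingle := Evaluable.sum <|
    .ite (.site_eq_query 0 (Fin.last 0)) (.prob 0 (Fin.last 0)) (.zero (d := e + 2) 0)
  simp only [Env.push_var_last] at hsingle
  refine .ite (.size_eq_one _) ?_ (.sub (.one _) ?_)
  · exact hsingle.mono (by omega)
  · exact (Evaluable.avoidSum le_rfl).mono (by omega)

theorem Env.membershipFormula_eq {E : Env (e + 2) 0} (hE : 1 ≤ E.size)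
    (h : LeadingGeneralPosition E.offset) (hparam : E.param = shearParam E.offset) :
    E.membershipFormula = membershipProb E.site E.pr E.query := by
  rw [Env.membershipFormula]
  split_ifs with hn
  · obtain ⟨n, site, pr, q, r, v⟩ := E
    obtain rfl : n = 1 := hn
    rw [membershipProb_fin_one, Fin.sum_univ_one]
  · have : Nontrivial (Fin E.size) := Fin.nontrivial_iff_two_le.2 (by omega)
    rw [membershipProb_eq_one_sub_avoidSum E.pr h, Env.sheared, hparam]
    rfl

end RealRAM

theorem mainTheorem2_general (d : ℕ) (hd : 2 ≤ d) :
    ∃ (prog : RealRAM.Program) (C : ℕ),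
      ∀ (n : ℕ), 1 ≤ n →
      ∀ (site : Fin n → Fin d → ℝ) (pr : Fin n → ℝ) (q : Fin d → ℝ),
        Unipoint.LeadingGeneralPosition (fun i => site i - q) →
        ∀ s : RealRAM.State, RealRAM.HoldsInput site pr q s →
          ∃ (t : ℕ) (s' : RealRAM.State),
            RealRAM.Exec (C * n) prog s t s' ∧
            t ≤ C * n ^ d ∧
            s'.rreg 0 = Unipoint.membershipProb site pr q := by
  obtain ⟨e, rfl⟩ : ∃ e, d = e + 2 := Nat.exists_eq_add_of_le' hd
  obtain ⟨prog, C, hrun⟩ := RealRAM.exists_program (d := e + 2)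
    (RealRAM.Evaluable.shearParam.mono (Nat.le_add_left 1 (e + 1))) .membershipFormula
  refine ⟨prog, C, fun n hn site pr q hpos s hs => ?_⟩
  obtain ⟨t, s', hexec, ht, hs'⟩ := hrun ⟨n, site, pr, q, 0, Fin.elim0⟩ hn s hs
  exact ⟨t, s', hexec, ht, hs'.trans (RealRAM.Env.membershipFormula_eq hn hpos rfl)⟩

/-- For every fixed `d ≥ 2` there is a real RAM program that, given `n ≥ 1` uncertain points in
the unipoint model and a query point `q` in `ℝ^d`, all in general position, computes (in
real register `0`) the membership probability of `q` in `O(n^d)` steps and `O(n)` space. -/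
theorem mainTheorem2 (d : ℕ) (hd : 2 ≤ d) :
    ∃ (prog : RealRAM.Program) (C : ℕ),
      ∀ (n : ℕ), 1 ≤ n →
      ∀ (site : Fin n → Fin d → ℝ) (pr : Fin n → ℝ) (q : Fin d → ℝ),
        (∀ i, 0 < pr i ∧ pr i ≤ 1) →
        Unipoint.GeneralPosition (Unipoint.withQuery site q) →
        ∀ s : RealRAM.State, RealRAM.HoldsInput site pr q s →
          ∃ (t : ℕ) (s' : RealRAM.State),
            RealRAM.Exec (C * n) prog s t s' ∧
            t ≤ C * n ^ d ∧
            s'.rreg 0 = Unipoint.membershipProb site pr q := by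
  obtain ⟨prog, C, hrun⟩ := mainTheorem2_general d hd
  exact ⟨prog, C, fun n hn site pr q _ hpos => hrun n hn site pr q hpos.leadingGeneralPosition⟩
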